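/- Let $X$ be a locally compact, second countable Hausdorff space, let $\mu$ be a Radon measure on $X$ with $\mu(U)>0$ for every nonempty open $U\subset X$, and let $(\mathcal{E},\mathcal{F})$ be a regular symmetric Dirichlet form on $L_2(X,\mu)$. Let $C_0(X)$ be the space of continuous functions with compact support, put $\mathcal{C}:=C_0(X)\cap\mathcal{F}$, normed by $\|f\|_{\mathcal{C}}:=\mathcal{E}(f,f)^{1/2}+\sup_X|f|$, and let $\mathcal{C}^*$ be its dual space with the dual norm. For $g,h\in\mathcal{C}$ let $\Gamma(g,h)$ be the finite signed Borel measure (the energy measure) determined by $$2\int_X f\,d\Gamma(g,h)=\mathcal{E}(fg,h)+\mathcal{E}(fh,g)-\mathcal{E}(gh,f),\qquad f\in\mathcal{C}.$$ Let $\mathcal{B}_b(X)$ be the space of bounded Borel functions, and let $\mathcal{H}$ be the Hilbert space obtained from $\mathcal{C}\otimes\mathcal{B}_b(X)$, with the semidefinite scalar product $\langle a\otimes b,c\otimes d\rangle_{\mathcal{H}}=\int_X bd\,d\Gamma(a,c)$, by factoring out the kernel of the seminorm and completing. For $f,g\in\mathcal{C}$ put $\partial f:=f\otimes\mathbf 1$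 and let $g\,\partial f:=f\otimes g$ be the simple vector field; as elements of $\mathcal H$ these are understood as classes. (All these objects are well defined: $\mathcal{C}$ is closed under products, $\Gamma(g,h)$ exists and is unique, and the scalar product above is a well-defined nonnegative symmetric bilinear form.) Then: 1. There is exactly one bounded linear operator $\partial^*:\mathcal{H}\to\mathcal{C}^*$ with $\partial^*(g\,\partial f)(u)=-\int_X g\,d\Gamma(f,u)$ for all $f,g,u\in\mathcal{C}$. It satisfies $\|\partial^*v\|_{\mathcal{C}^*}\le\sqrt2\,\|v\|_{\mathcal{H}}$ and $\partial^*v(u)=-\langle v,\partial u\rangle_{\mathcal{H}}$ for all $v\in\mathcal{H}$ and $u\in\mathcal{C}$. 2. For all $f,g\in\mathcal{C}$ the functionals $gLf:u\mapsto-\mathcal{E}(gu,f)$ and $\Gamma(f,g):u\mapsto\int_X u\,d\Gamma(f,g)$ on $\mathcal{C}$ belong to $\mathcal{C}^*$, and $\partial^*(g\,\partial f)=gLf+\Gamma(f,g)$ in $\mathcal{C}^*$. 3. If $\Gamma(g,h)(X)=\mathcal{E}(g,h)$ for all $g,h\in\mathcal{C}$ (as is the case when $\mathcal{E}$ has no killing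 part), then for every $f\in\mathcal{C}$ the functional $Lf:u\mapsto-\mathcal{E}(u,f)$ belongs to $\mathcal{C}^*$ and $Lf=\partial^*\partial f$. -/

import Mathlib

open MeasureTheory Filter Topology
open scoped CompactlySupported TensorProduct InnerProductSpace ENNReal

noncomputable section

section Basics

variable {X : Type*} [TopologicalSpace X] [MeasurableSpace X] [BorelSpace X]

/-- The class in `L²(X, μ)` of a continuous function with compact support. -/
def ccToL2 (μ : Measure X) [IsFiniteMeasureOnCompacts μ] : C_c(X, ℝ) →ₗ[ℝ] Lp ℝ 2 μ where
  toFun f := (f.continuous.memLp_of_hasCompactSupport (p := 2) (μ := μ) f.hasCompactSupport).toLp f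
  map_add' _ _ := MemLp.toLp_add _ _
  map_smul' _ _ := MemLp.toLp_const_smul _ _

variable (X) in
/-- The algebra of bounded Borel functions on `X`. -/
def BoundedBorel : Subalgebra ℝ (X → ℝ) where
  carrier := {b | Measurable b ∧ ∃ C : ℝ, ∀ x, |b x| ≤ C}
  mul_mem' := by
    rintro a b ⟨ha, A, hA⟩ ⟨hb, B, hB⟩
    refine ⟨ha.mul hb, A * B, fun x => ?_⟩
    rw [Pi.mul_apply, abs_mul]
    exact mul_le_mul (hA x) (hB x) (abs_nonneg _) ((abs_nonneg _).trans (hA x))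
  add_mem' := by
    rintro a b ⟨ha, A, hA⟩ ⟨hb, B, hB⟩
    exact ⟨ha.add hb, A + B, fun x => (abs_add_le _ _).trans (add_le_add (hA x) (hB x))⟩
  algebraMap_mem' r := ⟨measurable_const, |r|, fun _ => le_rfl⟩

/-- A symmetric Dirichlet form on `L²(X, μ)`: a densely defined, nonnegative, symmetric bilinear
form that is closed and on which the unit contraction `u ↦ min (max u 0) 1` operates. -/
structure DirichletForm (μ : Measure X) where
  /-- The domain of the form. -/
  domain : Submodule ℝ (Lp ℝ 2 μ)
  /-- The form itself. -/
  form : domain →ₗ[ℝ] domain →ₗ[ℝ] ℝ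
  dense_domain : Dense (domain : Set (Lp ℝ 2 μ))
  symm : ∀ u v, form u v = form v u
  nonneg : ∀ u, 0 ≤ form u u
  /-- The domain is complete for `ℰ₁(u) = ℰ(u, u) + ‖u‖²`. -/
  closed : ∀ u : ℕ → domain,
    (∀ ε > 0, ∃ N, ∀ m ≥ N, ∀ n ≥ N,
      form (u m - u n) (u m - u n) + ‖((u m - u n : domain) : Lp ℝ 2 μ)‖ ^ 2 < ε) →
    ∃ v : domain, Tendsto
      (fun n => form (u n - v) (u n - v) + ‖((u n - v : domain) : Lp ℝ 2 μ)‖ ^ 2) atTop (𝓝 0)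
  markov : ∀ (u : domain) (w : Lp ℝ 2 μ),
    (w =ᵐ[μ] fun x => min (max ((u : Lp ℝ 2 μ) x) 0) 1) →
    ∃ hw : w ∈ domain, form ⟨w, hw⟩ ⟨w, hw⟩ ≤ form u u

end Basics

namespace DirichletForm

variable {X : Type*} [TopologicalSpace X] [MeasurableSpace X] [BorelSpace X]
  {μ : Measure X} [IsFiniteMeasureOnCompacts μ] (E : DirichletForm μ)

/-- The continuous functions with compact support whose class belongs to the domain. -/
def core : Submodule ℝ C_c(X, ℝ) := E.domain.comap (ccToL2 μ)

/-- Regularity: the core is dense in the domain for the norm `ℰ₁(u)^{1/2}`, and dense in the space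
of continuous functions with compact support for the uniform norm. -/
def IsRegular : Prop :=
  (∀ (u : E.domain), ∀ ε > 0, ∃ f : E.core,
    E.form (u - ⟨ccToL2 μ f, f.2⟩) (u - ⟨ccToL2 μ f, f.2⟩) +
      ‖(u : Lp ℝ 2 μ) - ccToL2 μ f‖ ^ 2 < ε) ∧
  (∀ (f : C_c(X, ℝ)), ∀ ε > 0, ∃ g : E.core, ∀ x, |f x - (g : C_c(X, ℝ)) x| < ε)

open Classical in
/-- `ℰ(f, g)` for continuous functions with compact support. (The value is `0` if `f` or `g` is
not in the domain of the form.) -/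
def energy (f g : C_c(X, ℝ)) : ℝ :=
  if h : f ∈ E.core ∧ g ∈ E.core then E.form ⟨ccToL2 μ f, h.1⟩ ⟨ccToL2 μ g, h.2⟩ else 0

/-- The space `𝒞` of energy finite continuous functions with compact support. It is equipped below
with the norm `‖f‖ = ℰ(f)^{1/2} + sup |f|`. -/
def Core : Type _ := E.core

instance : AddCommGroup E.Core := inferInstanceAs (AddCommGroup E.core)

instance : Module ℝ E.Core := inferInstanceAs (Module ℝ E.core)

/-- An element of the core as a continuous function with compact support. -/
def Core.val {E : DirichletForm μ} (f : E.Core) : C_c(X, ℝ) := Subtype.val f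

instance : CoeOut E.Core C_c(X, ℝ) := ⟨Core.val⟩

instance : Norm E.Core := ⟨fun f => √(E.energy f f) + ⨆ x, |(f : C_c(X, ℝ)) x|⟩

theorem Core.norm_def (f : E.Core) :
    ‖f‖ = √(E.energy f f) + ⨆ x, |(f : C_c(X, ℝ)) x| := rfl

theorem Core.energy_eq (f g : E.Core) :
    E.energy f g = E.form ⟨ccToL2 μ f, f.2⟩ ⟨ccToL2 μ g, g.2⟩ :=
  dif_pos ⟨f.2, g.2⟩

theorem Core.bddAbove (f : E.Core) : BddAbove (Set.range fun x => |(f : C_c(X, ℝ)) x|) := by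
  obtain ⟨C, hC⟩ := (f : C_c(X, ℝ)).hasCompactSupport.exists_bound_of_continuous
    (f : C_c(X, ℝ)).continuous
  exact ⟨C, by rintro _ ⟨x, rfl⟩; exact hC x⟩

/-- The form as a semidefinite inner product on its domain. -/
@[reducible] def formCore : PreInnerProductSpace.Core ℝ E.domain where
  inner u v := E.form u v
  conj_inner_symm u v := E.symm v u
  re_inner_nonneg u := E.nonneg u
  add_left u v w := by simp
  smul_left u v r := by simp

theorem Core.normCore : NormedSpace.Core ℝ E.Core where
  norm_nonneg f := add_nonneg (Real.sqrt_nonneg _) (Real.iSup_nonneg fun _ => abs_nonneg _)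
  norm_smul c f := by
    have h1 : E.energy (c • f : E.Core) (c • f : E.Core) = c ^ 2 * E.energy f f := by
      rw [Core.energy_eq, Core.energy_eq]
      have : (⟨ccToL2 μ (c • f : E.Core), (c • f : E.Core).2⟩ : E.domain) =
          c • ⟨ccToL2 μ f, f.2⟩ := Subtype.ext (map_smul (ccToL2 μ) c (f : C_c(X, ℝ)))
      rw [this]; simp; ring
    have h2 : (⨆ x, |((c • f : E.Core) : C_c(X, ℝ)) x|) = |c| * ⨆ x, |(f : C_c(X, ℝ)) x| := by
      rw [Real.mul_iSup_of_nonneg (abs_nonneg c)]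
      exact iSup_congr fun x => abs_mul c _
    rw [Core.norm_def, Core.norm_def, h1, h2, Real.sqrt_mul (sq_nonneg c), Real.sqrt_sq_eq_abs,
      Real.norm_eq_abs]
    ring
  norm_triangle f g := by
    have h1 : √(E.energy (f + g : E.Core) (f + g : E.Core)) ≤
        √(E.energy f f) + √(E.energy g g) := by
      rw [Core.energy_eq, Core.energy_eq, Core.energy_eq]
      have : (⟨ccToL2 μ (f + g : E.Core), (f + g : E.Core).2⟩ : E.domain) =
          ⟨ccToL2 μ f, f.2⟩ + ⟨ccToL2 μ g, g.2⟩ :=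
        Subtype.ext (map_add (ccToL2 μ) (f : C_c(X, ℝ)) g)
      rw [this]
      exact @norm_add_le _ (@InnerProductSpace.Core.toSeminormedAddCommGroup ℝ E.domain _ _ _
        E.formCore).toSeminormedAddGroup _ _
    have h2 : (⨆ x, |((f + g : E.Core) : C_c(X, ℝ)) x|) ≤
        (⨆ x, |(f : C_c(X, ℝ)) x|) + ⨆ x, |(g : C_c(X, ℝ)) x| := by
      refine Real.iSup_le (fun x => ?_) (add_nonneg (Real.iSup_nonneg fun _ => abs_nonneg _)
        (Real.iSup_nonneg fun _ => abs_nonneg _))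
      exact (abs_add_le _ _).trans (add_le_add (le_ciSup (Core.bddAbove E f) x)
        (le_ciSup (Core.bddAbove E g) x))
    rw [Core.norm_def, Core.norm_def, Core.norm_def]
    linarith
  norm_eq_zero_iff f := by
    constructor
    · intro h
      have h1 : (⨆ x, |(f : C_c(X, ℝ)) x|) ≤ 0 := by
        rw [Core.norm_def] at h
        linarith [Real.sqrt_nonneg (E.energy f f)]
      refine Subtype.ext (CompactlySupportedContinuousMap.ext fun x => ?_)
      exact abs_nonpos_iff.1 ((le_ciSup (Core.bddAbove E f) x).trans h1)
    · rintro rfl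
      have h1 : E.energy (0 : E.Core) (0 : E.Core) = 0 := by
        rw [Core.energy_eq]
        have : (⟨ccToL2 μ (0 : E.Core), (0 : E.Core).2⟩ : E.domain) = 0 :=
          Subtype.ext (map_zero (ccToL2 μ))
        rw [this]; simp
      have h2 : ∀ x, |((0 : E.Core) : C_c(X, ℝ)) x| = 0 := fun x => abs_zero
      simp only [Core.norm_def, h1, h2, Real.sqrt_zero, Real.iSup_const_zero, add_zero]

instance : NormedAddCommGroup E.Core := NormedAddCommGroup.ofCore (Core.normCore E)

instance : NormedSpace ℝ E.Core := NormedSpace.ofCore (Core.normCore E)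

/-- The Banach space `𝒞*` of bounded linear functionals on the core, with the operator norm. -/
abbrev CoreDual : Type _ := StrongDual ℝ E.Core

/-- The defining property of the energy measure `Γ(g, h)`:
`2 ∫ f dΓ(g, h) = ℰ(fg, h) + ℰ(fh, g) - ℰ(gh, f)` for all `f` in the core. -/
def IsEnergyMeasure (g h : E.Core) (ν : SignedMeasure X) : Prop :=
  ∀ f : E.Core, 2 * ∫ᵛ x, (f : C_c(X, ℝ)) x ∂•ν =
    E.energy ((f : C_c(X, ℝ)) * g) h + E.energy ((f : C_c(X, ℝ)) * h) g
      - E.energy ((g : C_c(X, ℝ)) * h) f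

open Classical in
/-- The (signed) energy measure `Γ(g, h)`, the finite signed measure determined by
`IsEnergyMeasure`. -/
def energyMeasure (g h : E.Core) : SignedMeasure X :=
  if H : ∃ ν, E.IsEnergyMeasure g h ν then H.choose else 0

/-- The space `𝒞 ⊗ B_b(X)`, before taking the quotient and completing. -/
def PreOneForm : Type _ := E.Core ⊗[ℝ] BoundedBorel X

instance : AddCommGroup E.PreOneForm :=
  inferInstanceAs (AddCommGroup (E.Core ⊗[ℝ] BoundedBorel X))

instance : Module ℝ E.PreOneForm := inferInstanceAs (Module ℝ (E.Core ⊗[ℝ] BoundedBorel X))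

/-- The simple tensor `a ⊗ b`. -/
def preTensor (a : E.Core) (b : BoundedBorel X) : E.PreOneForm := a ⊗ₜ[ℝ] b

/-- `B` is the nonnegative symmetric bilinear form on `𝒞 ⊗ B_b(X)` given on simple tensors by
`⟨a ⊗ b, c ⊗ d⟩ = ∫ b d dΓ(a, c)`. -/
structure IsOneFormProduct (B : LinearMap.BilinForm ℝ E.PreOneForm) : Prop where
  apply_tensor : ∀ (a c : E.Core) (b d : BoundedBorel X),
    B (E.preTensor a b) (E.preTensor c d) =
      ∫ᵛ x, (b : X → ℝ) x * (d : X → ℝ) x ∂•(E.energyMeasure a c)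
  symm : ∀ v w, B v w = B w v
  nonneg : ∀ v, 0 ≤ B v v

open Classical in
/-- The semidefinite scalar product on `𝒞 ⊗ B_b(X)`, determined by `IsOneFormProduct`. -/
def oneFormProduct : LinearMap.BilinForm ℝ E.PreOneForm :=
  if H : ∃ B, E.IsOneFormProduct B then H.choose else 0

theorem oneFormProduct_symm (v w : E.PreOneForm) :
    E.oneFormProduct v w = E.oneFormProduct w v := by
  unfold oneFormProduct
  split_ifs with H
  · exact H.choose_spec.symm v w
  · rfl

theorem oneFormProduct_nonneg (v : E.PreOneForm) : 0 ≤ E.oneFormProduct v v := by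
  unfold oneFormProduct
  split_ifs with H
  · exact H.choose_spec.nonneg v
  · exact le_rfl

instance preOneFormCore : PreInnerProductSpace.Core ℝ E.PreOneForm where
  inner v w := E.oneFormProduct v w
  conj_inner_symm v w := E.oneFormProduct_symm w v
  re_inner_nonneg v := E.oneFormProduct_nonneg v
  add_left u v w := by simp
  smul_left u v r := by simp

instance : SeminormedAddCommGroup E.PreOneForm :=
  InnerProductSpace.Core.toSeminormedAddCommGroup (𝕜 := ℝ) (F := E.PreOneForm)

instance : InnerProductSpace ℝ E.PreOneForm := InnerProductSpace.ofCore E.preOneFormCore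

/-- The Hilbert space `ℋ` of differential `1`-forms: the Hausdorff completion of `𝒞 ⊗ B_b(X)`, that
is, the completion of its quotient by the kernel of the seminorm. -/
abbrev OneForm : Type _ := UniformSpace.Completion E.PreOneForm

/-- The class `a ⊗ b` in `ℋ` of a simple tensor. -/
def tensor (a : E.Core) (b : BoundedBorel X) : E.OneForm := (E.preTensor a b : E.OneForm)

/-- The differential (gradient) `∂ a = a ⊗ 1`. -/
def grad (a : E.Core) : E.OneForm := E.tensor a 1

/-- An element of the core as a bounded Borel function. -/
def Core.toBoundedBorel {E : DirichletForm μ} (f : E.Core) : BoundedBorel X :=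
  ⟨fun x => (f : C_c(X, ℝ)) x, (f : C_c(X, ℝ)).continuous.measurable,
    (f : C_c(X, ℝ)).hasCompactSupport.exists_bound_of_continuous (f : C_c(X, ℝ)).continuous⟩

/-- The simple vector field `g ∂ f`, that is, the class of `f ⊗ g`: the `1`-form `∂ f` multiplied
by `g` through the right action of `B_b(X)` on `ℋ`. -/
def simpleField (g f : E.Core) : E.OneForm := E.tensor f g.toBoundedBorel

/-- `D` is a divergence operator: a bounded linear extension to `ℋ`, with values in `𝒞*`, of the
map which sends a simple vector field `g ∂ f` to the functional `u ↦ -∫ g dΓ(f, u)`. -/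
def IsDivergence (D : E.OneForm →L[ℝ] E.CoreDual) : Prop :=
  ∀ g f u : E.Core,
    D (E.simpleField g f) u = -∫ᵛ x, (g : C_c(X, ℝ)) x ∂•(E.energyMeasure f u)

/-- The functional `g L f`: `(g L f)(u) = -ℰ(g u, f)`. -/
def mulGenerator (g f : E.Core) (u : E.Core) : ℝ :=
  -E.energy ((g : C_c(X, ℝ)) * u) f

/-- The functional `L f`: `(L f)(u) = -ℰ(u, f)`. -/
def generator (f : E.Core) (u : E.Core) : ℝ := -E.energy u f

/-- The energy measure `Γ(f, g)` as a functional: `Γ(f, g)(u) = ∫ u dΓ(f, g)`. -/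
def energyFunctional (f g : E.Core) (u : E.Core) : ℝ :=
  ∫ᵛ x, (u : C_c(X, ℝ)) x ∂•(E.energyMeasure f g)

end DirichletForm

end

/-! The divergence is minus the adjoint of the gradient, `∂*v(u) = -⟨v, ∂u⟩`. It is bounded because
`‖∂u‖² = Γ(u, u)(X) ≤ 2 ℰ(u, u)`, and unique because simple fields span a dense subspace of `ℋ`. The
formula for `∂*(g ∂f)` comes from adding the identity defining `Γ(f, u)`, tested against `g`, to the
one defining `Γ(f, g)`, tested against `u`: all terms but `ℰ(gu, f)` cancel.

Most of the work is the existence of these objects. The resolvent `T = (1 + tA)⁻¹` comes from Riesz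
representation; as the solution of a minimum problem it is Markovian (`resolvent_mem_Icc`). The
forms `t⁻¹⟨u - Tu, v⟩` are defined on all of `L²`, converge to `ℰ` along `t = 1/(n+1)`, and detect
its domain by boundedness. Their carré du champ is explicit, `t⁻¹ ∫ f (T(u²) - 2u Tu + u²)`, hence
positive in `f` and controlled by `sup |f|` uniformly in `t`. In the limit the core is an algebra
(`mul_mem_core`) and the functional defining `Γ(u, u)` is positive and bounded.

The M. Riesz extension theorem and Riesz–Markov–Kakutani turn this functional into a finite measure,
and polarization gives `Γ(g, h)`. Uniform density of the core makes it unique, hence bilinear.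
Positivity of the scalar product on `𝒞 ⊗ B_b(X)` is checked on simple coefficients and passes to the
limit. -/

noncomputable section

/-! ### Riesz representation -/

section Riesz

variable {V : Type*} [AddCommGroup V] [Module ℝ V]

/-- The Riesz representation theorem for a vector space which is complete for a given symmetric
positive definite bilinear form. -/
theorem LinearMap.exists_eq_apply_of_complete (B : V →ₗ[ℝ] V →ₗ[ℝ] ℝ) (symm : ∀ u v, B u v = B v u)
    (pos : ∀ v, 0 ≤ B v v) (definite : ∀ v, B v v = 0 → v = 0)
    (complete : ∀ u : ℕ → V, (∀ ε > 0, ∃ N, ∀ m ≥ N, ∀ n ≥ N, B (u m - u n) (u m - u n) < ε) →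
      ∃ v, Tendsto (fun n => B (u n - v) (u n - v)) atTop (𝓝 0))
    (f : V →ₗ[ℝ] ℝ) (C : ℝ) (hf : ∀ v, |f v| ≤ C * √(B v v)) : ∃ w, ∀ v, B w v = f v := by
  let core : InnerProductSpace.Core ℝ V :=
    { inner u v := B u v
      conj_inner_symm u v := symm v u
      re_inner_nonneg u := pos u
      add_left u v w := by simp
      smul_left u v r := by simp
      definite u h := definite u h }
  let _ : NormedAddCommGroup V := core.toNormedAddCommGroup
  let _ : InnerProductSpace ℝ V := InnerProductSpace.ofCore core.toCore
  have hinner : ∀ u v : V, ⟪u, v⟫_ℝ = B u v := fun _ _ => rfl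
  have hnorm : ∀ v : V, ‖v‖ ^ 2 = B v v := fun v => by rw [← real_inner_self_eq_norm_sq, hinner]
  have hnorm' : ∀ v : V, ‖v‖ = √(B v v) := fun v => by
    rw [← hnorm, Real.sqrt_sq (norm_nonneg v)]
  have : CompleteSpace V := by
    refine Metric.complete_of_cauchySeq_tendsto fun u hu => ?_
    obtain ⟨v, hv⟩ := complete u fun ε hε => by
      obtain ⟨N, hN⟩ := Metric.cauchySeq_iff.1 hu (√ε) (Real.sqrt_pos.2 hε)
      refine ⟨N, fun m hm n hn => ?_⟩
      have h := hN m hm n hn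
      rw [dist_eq_norm, hnorm'] at h
      exact (Real.sqrt_lt_sqrt_iff (pos _)).1 h
    refine ⟨v, tendsto_iff_norm_sub_tendsto_zero.2 ?_⟩
    have h := hv.sqrt
    rw [Real.sqrt_zero] at h
    exact h.congr fun n => (hnorm' _).symm
  let F : StrongDual ℝ V := f.mkContinuous C fun v => by
    rw [Real.norm_eq_abs, hnorm']; exact hf v
  refine ⟨(InnerProductSpace.toDual ℝ V).symm F, fun v => ?_⟩
  rw [← hinner, InnerProductSpace.toDual_symm_apply]
  rfl

end Riesz

/-! ### Resolvent and approximating forms -/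

namespace DirichletForm

variable {X : Type*} [MeasurableSpace X] {μ : Measure X} (E : DirichletForm μ)

theorem form_cauchySchwarz (u v : E.domain) :
    E.form u v ^ 2 ≤ E.form u u * E.form v v := by
  have h := @InnerProductSpace.Core.inner_mul_inner_self_le ℝ E.domain _ _ _ E.formCore u v
  have h1 : ‖E.form u v‖ * ‖E.form v u‖ ≤ E.form u u * E.form v v := h
  rwa [E.symm v u, Real.norm_eq_abs, ← pow_two, sq_abs] at h1

/-- Riesz representation for the scalar product `t ℰ + ⟨·, ·⟩`, for which closedness makes the
domain complete. -/
theorem exists_resolvent {t : ℝ} (ht : 0 < t) : ∃ R : Lp ℝ 2 μ →ₗ[ℝ] E.domain,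
    ∀ (u : Lp ℝ 2 μ) (v : E.domain),
      t * E.form (R u) v + ⟪(R u : Lp ℝ 2 μ), (v : Lp ℝ 2 μ)⟫_ℝ = ⟪u, (v : Lp ℝ 2 μ)⟫_ℝ := by
  let B : E.domain →ₗ[ℝ] E.domain →ₗ[ℝ] ℝ := t • E.form +
    ((innerₗ (Lp ℝ 2 μ)).compl₁₂ E.domain.subtype E.domain.subtype)
  have hB : ∀ u v, B u v = t * E.form u v + ⟪(u : Lp ℝ 2 μ), (v : Lp ℝ 2 μ)⟫_ℝ := fun u v => rfl
  have hB' : ∀ u, B u u = t * E.form u u + ‖(u : Lp ℝ 2 μ)‖ ^ 2 := fun u => by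
    rw [hB, real_inner_self_eq_norm_sq]
  have pos : ∀ u : E.domain, ‖(u : Lp ℝ 2 μ)‖ ^ 2 ≤ B u u := fun u => by
    rw [hB']; nlinarith [mul_nonneg ht.le (E.nonneg u)]
  have definite : ∀ v, B v v = 0 → v = 0 := fun v hv => by
    have h := pos v
    rw [hv] at h
    exact Subtype.ext (norm_eq_zero.1 (pow_eq_zero_iff two_ne_zero |>.1 (le_antisymm h (sq_nonneg _))))
  have key : ∀ u : Lp ℝ 2 μ, ∃ w, ∀ v, B w v = ⟪u, (v : Lp ℝ 2 μ)⟫_ℝ := fun u => by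
    refine LinearMap.exists_eq_apply_of_complete B
      (fun u v => by rw [hB, hB, E.symm, real_inner_comm]) (fun u => (sq_nonneg _).trans (pos u))
      definite (fun w hw => ?_) ((innerₗ (Lp ℝ 2 μ) u) ∘ₗ E.domain.subtype) ‖u‖ fun v => ?_
    -- `B` is equivalent to `ℰ₁`: the factor `min t 1` transfers the Cauchy property to `ℰ₁`, and
    -- `max t 1` transfers convergence back.
    · obtain ⟨v, hv⟩ := E.closed w fun ε hε => by
        obtain ⟨N, hN⟩ := hw (min t 1 * ε) (by positivity)
        refine ⟨N, fun m hm n hn => ?_⟩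
        have h := hN m hm n hn
        rw [hB'] at h
        have h1 : min t 1 * (E.form (w m - w n) (w m - w n) +
            ‖((w m - w n : E.domain) : Lp ℝ 2 μ)‖ ^ 2) ≤ t * E.form (w m - w n) (w m - w n) +
            ‖((w m - w n : E.domain) : Lp ℝ 2 μ)‖ ^ 2 := by
          have := mul_le_mul_of_nonneg_right (min_le_left t 1) (E.nonneg (w m - w n))
          have := mul_le_mul_of_nonneg_right (min_le_right t 1)
            (sq_nonneg ‖((w m - w n : E.domain) : Lp ℝ 2 μ)‖)
          linarith
        exact lt_of_mul_lt_mul_left (h1.trans_lt h) (by positivity)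
      refine ⟨v, squeeze_zero (fun n => (sq_nonneg _).trans (pos _)) (fun n => ?_)
        (by simpa only [mul_zero] using hv.const_mul (max t 1))⟩
      rw [hB']
      have := mul_le_mul_of_nonneg_right (le_max_left t 1) (E.nonneg (w n - v))
      have := mul_le_mul_of_nonneg_right (le_max_right t 1)
        (sq_nonneg ‖((w n - v : E.domain) : Lp ℝ 2 μ)‖)
      linarith
    · refine (abs_real_inner_le_norm u v).trans ?_
      gcongr
      exact Real.le_sqrt_of_sq_le (pos v)
  choose R hR using key
  have ext : ∀ w w' : E.domain, (∀ v, B w v = B w' v) → w = w' := fun w w' h =>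
    sub_eq_zero.1 (definite _ (by
      rw [map_sub B, LinearMap.sub_apply, h, sub_self]))
  refine ⟨{ toFun := R, map_add' := fun u v => ext _ _ fun w => ?_,
            map_smul' := fun c u => ext _ _ fun w => ?_ }, hR⟩
  · simp only [map_add, LinearMap.add_apply, hR, inner_add_left]
  · simp only [map_smul, LinearMap.smul_apply, hR, real_inner_smul_left, RingHom.id_apply,
      smul_eq_mul]

open Classical in
/-- The operator `(1 + t A)⁻¹`, where `A` is the generator of the form. -/
def resolvent (t : ℝ) : Lp ℝ 2 μ →ₗ[ℝ] E.domain :=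
  if ht : 0 < t then (E.exists_resolvent ht).choose else 0

variable {t : ℝ}

theorem resolvent_spec (ht : 0 < t) (u : Lp ℝ 2 μ) (v : E.domain) :
    t * E.form (E.resolvent t u) v + ⟪(E.resolvent t u : Lp ℝ 2 μ), (v : Lp ℝ 2 μ)⟫_ℝ =
      ⟪u, (v : Lp ℝ 2 μ)⟫_ℝ := by
  have h := (E.exists_resolvent ht).choose_spec u v
  simpa only [resolvent, dif_pos ht] using h

theorem inner_resolvent_comm (ht : 0 < t) (u v : Lp ℝ 2 μ) :
    ⟪(E.resolvent t u : Lp ℝ 2 μ), v⟫_ℝ = ⟪u, (E.resolvent t v : Lp ℝ 2 μ)⟫_ℝ := by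
  rw [← E.resolvent_spec ht u, real_inner_comm, ← E.resolvent_spec ht v, E.symm, real_inner_comm]

/-- `E.resolvent t u` minimizes `v ↦ t * ℰ(v, v) + ‖v - u‖ ^ 2`. -/
theorem resolvent_minimizes (ht : 0 < t) (u : Lp ℝ 2 μ) (v : E.domain) :
    t * E.form v v + ‖(v : Lp ℝ 2 μ) - u‖ ^ 2 =
      (t * E.form (E.resolvent t u) (E.resolvent t u) + ‖(E.resolvent t u : Lp ℝ 2 μ) - u‖ ^ 2) +
      (t * E.form (v - E.resolvent t u) (v - E.resolvent t u) +
        ‖(v : Lp ℝ 2 μ) - E.resolvent t u‖ ^ 2) := by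
  have h1 := E.resolvent_spec ht u v
  have h2 := E.resolvent_spec ht u (E.resolvent t u)
  have h3 := E.symm v (E.resolvent t u)
  simp only [← real_inner_self_eq_norm_sq, inner_sub_left, inner_sub_right, map_sub,
    LinearMap.sub_apply] at *
  rw [real_inner_comm u (v : Lp ℝ 2 μ), real_inner_comm u (E.resolvent t u : Lp ℝ 2 μ),
    real_inner_comm (E.resolvent t u : Lp ℝ 2 μ) (v : Lp ℝ 2 μ), h3]
  linarith

/-- Truncating to `[0, 1]` increases neither the energy (Markov property) nor the distance to `u`,
which already takes values in `[0, 1]`. The truncated resolvent is therefore also a minimizer, and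
the minimizer is unique. -/
theorem resolvent_mem_Icc (ht : 0 < t) (u : Lp ℝ 2 μ) (hu : ∀ᵐ x ∂μ, u x ∈ Set.Icc (0 : ℝ) 1) :
    ∀ᵐ x ∂μ, (E.resolvent t u : Lp ℝ 2 μ) x ∈ Set.Icc (0 : ℝ) 1 := by
  set w := E.resolvent t u with hw
  have hmem : MemLp (fun x => min (max ((w : Lp ℝ 2 μ) x) 0) 1) 2 μ := by
    refine (Lp.memLp (w : Lp ℝ 2 μ)).mono
      (((Lp.aestronglyMeasurable _).sup aestronglyMeasurable_const).inf
        aestronglyMeasurable_const) (ae_of_all _ fun x => ?_)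
    rw [Real.norm_eq_abs, Real.norm_eq_abs, abs_of_nonneg (le_min (le_max_right _ _) zero_le_one)]
    exact (min_le_left _ _).trans (max_le (le_abs_self _) (abs_nonneg _))
  obtain ⟨hv, hle⟩ := E.markov w (hmem.toLp _) hmem.coeFn_toLp
  have hnorm : ‖hmem.toLp _ - u‖ ≤ ‖(w : Lp ℝ 2 μ) - u‖ := by
    refine Lp.norm_le_norm_of_ae_le ?_
    filter_upwards [hu, hmem.coeFn_toLp, Lp.coeFn_sub (hmem.toLp _) u,
      Lp.coeFn_sub (w : Lp ℝ 2 μ) u] with x hx h1 h2 h3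
    rw [h2, h3, Pi.sub_apply, Pi.sub_apply, h1, Real.norm_eq_abs, Real.norm_eq_abs]
    obtain ⟨h0, h1⟩ := hx
    rcases le_total ((w : Lp ℝ 2 μ) x) 0 with h | h
    · rw [max_eq_right h, min_eq_left zero_le_one, ← sq_le_sq]; nlinarith
    · rw [max_eq_left h]
      rcases le_total ((w : Lp ℝ 2 μ) x) 1 with h' | h'
      · rw [min_eq_left h']
      · rw [min_eq_right h', abs_of_nonneg (by linarith), abs_of_nonneg (by linarith)]
        linarith
  have h := E.resolvent_minimizes ht u ⟨_, hv⟩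
  rw [← hw] at h
  have h2 : ‖hmem.toLp _ - u‖ ^ 2 ≤ ‖(w : Lp ℝ 2 μ) - u‖ ^ 2 := by gcongr
  have h3 : ‖hmem.toLp _ - (w : Lp ℝ 2 μ)‖ ^ 2 ≤ 0 := by
    have := mul_le_mul_of_nonneg_left hle ht.le
    have := mul_nonneg ht.le (E.nonneg (⟨_, hv⟩ - w))
    simp only at h
    linarith
  have h4 : hmem.toLp _ = (w : Lp ℝ 2 μ) := by
    rw [← sub_eq_zero, ← norm_eq_zero]
    exact pow_eq_zero_iff two_ne_zero |>.1 (le_antisymm h3 (sq_nonneg _))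
  have h5 := hmem.coeFn_toLp
  rw [h4] at h5
  filter_upwards [h5] with x hx
  rw [hx]
  exact ⟨le_min (le_max_right _ _) zero_le_one, min_le_right _ _⟩

/-- The approximating form `t⁻¹ ⟨u - (1 + t A)⁻¹ u, v⟩`. -/
def approxForm (t : ℝ) (u v : Lp ℝ 2 μ) : ℝ := t⁻¹ * ⟪u - E.resolvent t u, v⟫_ℝ

theorem approxForm_eq_form (ht : 0 < t) (u : Lp ℝ 2 μ) (v : E.domain) :
    E.approxForm t u v = E.form (E.resolvent t u) v := by
  rw [approxForm, inner_sub_left, ← E.resolvent_spec ht u v]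
  field_simp
  ring

/-- Identifies the minimum in `resolvent_minimizes`; comparison with competitors then yields bounds
and monotonicity. -/
theorem mul_approxForm_self (ht : 0 < t) (u : Lp ℝ 2 μ) :
    t * E.approxForm t u u =
      t * E.form (E.resolvent t u) (E.resolvent t u) + ‖(E.resolvent t u : Lp ℝ 2 μ) - u‖ ^ 2 := by
  have h := E.resolvent_spec ht u (E.resolvent t u)
  rw [approxForm, mul_inv_cancel_left₀ ht.ne']
  simp only [← real_inner_self_eq_norm_sq, inner_sub_left, inner_sub_right] at *
  rw [real_inner_comm u (E.resolvent t u : Lp ℝ 2 μ)] at *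
  linarith

theorem approxForm_self_le (ht : 0 < t) (u : E.domain) : E.approxForm t u u ≤ E.form u u := by
  have h := E.resolvent_minimizes ht u u
  rw [← E.mul_approxForm_self ht, sub_self, norm_zero] at h
  have := mul_nonneg ht.le (E.nonneg (u - E.resolvent t u))
  refine le_of_mul_le_mul_left ?_ ht
  nlinarith [sq_nonneg ‖(u : Lp ℝ 2 μ) - E.resolvent t u‖]

/-- The sharp form of the monotonicity of `approxForm t u u` in `t`. -/
theorem form_resolvent_sub_le {s : ℝ} (hs : 0 < s) (hst : s ≤ t) (u : Lp ℝ 2 μ) :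
    E.form (E.resolvent s u - E.resolvent t u) (E.resolvent s u - E.resolvent t u) ≤
      E.approxForm s u u - E.approxForm t u u := by
  have ht := hs.trans_le hst
  -- The minimizer for `s` serves as competitor in the problem for `t`; since `s ≤ t`, replacing `a`
  -- by `t / s * a` only loses.
  have h := E.resolvent_minimizes ht u (E.resolvent s u)
  rw [← E.mul_approxForm_self ht] at h
  have h1 := E.mul_approxForm_self hs u
  set a := ‖(E.resolvent s u : Lp ℝ 2 μ) - u‖ ^ 2
  have ha : 0 ≤ a := sq_nonneg _
  have h2 : t * E.approxForm s u u = t * E.form (E.resolvent s u) (E.resolvent s u) + t / s * a := by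
    have : E.approxForm s u u = E.form (E.resolvent s u) (E.resolvent s u) + a / s := by
      field_simp; linarith
    rw [this]; ring
  have h3 : a ≤ t / s * a := le_mul_of_one_le_left ha ((one_le_div hs).2 hst)
  refine le_of_mul_le_mul_left ?_ ht
  nlinarith [sq_nonneg ‖(E.resolvent s u : Lp ℝ 2 μ) - E.resolvent t u‖]

/-- The approximating energies increase as `t` decreases, so a bound makes them Cauchy. By
`form_resolvent_sub_le` the resolvents are then Cauchy in energy, and closedness puts their `L²`
limit `u` in the domain. -/
theorem mem_domain_of_approxForm_le (u : Lp ℝ 2 μ) (C : ℝ)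
    (hC : ∀ n : ℕ, E.approxForm (1 / (n + 1)) u u ≤ C) :
    ∃ hu : u ∈ E.domain, Tendsto (fun n : ℕ => E.form
      (E.resolvent (1 / (n + 1)) u - ⟨u, hu⟩) (E.resolvent (1 / (n + 1)) u - ⟨u, hu⟩))
      atTop (𝓝 0) := by
  set w : ℕ → E.domain := fun n => E.resolvent (1 / (n + 1)) u with hw
  set e : ℕ → ℝ := fun n => E.approxForm (1 / (n + 1)) u u with he
  have hr : ∀ n : ℕ, (0 : ℝ) < 1 / (n + 1) := fun n => Nat.one_div_pos_of_nat
  have hsub : ∀ m n, n ≤ m → E.form (w m - w n) (w m - w n) ≤ e m - e n := fun m n h =>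
    E.form_resolvent_sub_le (hr m) (Nat.one_div_le_one_div h) u
  have hmono : Monotone e := fun n m h => sub_nonneg.1 ((E.nonneg _).trans (hsub m n h))
  have hecauchy : CauchySeq e :=
    (tendsto_atTop_ciSup hmono ⟨C, by rintro _ ⟨n, rfl⟩; exact hC n⟩).cauchySeq
  -- `‖Tu - u‖²` is at most `t` times the approximating energy, hence at most `t * C`.
  have hwu : Tendsto (fun n => (w n : Lp ℝ 2 μ)) atTop (𝓝 u) := by
    rw [tendsto_iff_norm_sub_tendsto_zero]
    have h0 : Tendsto (fun n : ℕ => √(1 / ((n : ℝ) + 1) * C)) atTop (𝓝 0) := by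
      have := ((tendsto_one_div_add_atTop_nhds_zero_nat (𝕜 := ℝ)).mul_const C).sqrt
      simpa using this
    refine squeeze_zero (fun n => norm_nonneg _) (fun n => Real.le_sqrt_of_sq_le ?_) h0
    have h1 := E.mul_approxForm_self (hr n) u
    have h2 := mul_nonneg (hr n).le (E.nonneg (w n))
    have h3 := mul_le_mul_of_nonneg_left (hC n) (hr n).le
    simp only [hw] at *
    linarith
  have hform_swap : ∀ m n, E.form (w m - w n) (w m - w n) = E.form (w n - w m) (w n - w m) := by
    intro m n
    rw [← neg_sub (w n), map_neg, map_neg, LinearMap.neg_apply, neg_neg]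
  obtain ⟨v, hv⟩ := E.closed w fun ε hε => by
    obtain ⟨N, hN⟩ := Metric.cauchySeq_iff.1 hecauchy (ε / 2) (by positivity)
    obtain ⟨N', hN'⟩ := Metric.cauchySeq_iff.1 hwu.cauchySeq (√(ε / 2)) (by positivity)
    refine ⟨max N N', fun m hm n hn => ?_⟩
    have h1 : E.form (w m - w n) (w m - w n) < ε / 2 := by
      have h := hN m ((le_max_left _ _).trans hm) n ((le_max_left _ _).trans hn)
      rw [Real.dist_eq, abs_lt] at h
      rcases le_total n m with hnm | hnm
      · linarith [hsub m n hnm]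
      · rw [hform_swap]; linarith [hsub n m hnm]
    have h2 := hN' m ((le_max_right _ _).trans hm) n ((le_max_right _ _).trans hn)
    rw [dist_eq_norm, Real.lt_sqrt (norm_nonneg _)] at h2
    simp only [Submodule.coe_sub]
    linarith
  have hvu : (v : Lp ℝ 2 μ) = u := by
    refine tendsto_nhds_unique ?_ hwu
    rw [tendsto_iff_norm_sub_tendsto_zero]
    have h0 := hv.sqrt
    rw [Real.sqrt_zero] at h0
    refine squeeze_zero (fun n => norm_nonneg _) (fun n => Real.le_sqrt_of_sq_le ?_) h0
    simp only [Submodule.coe_sub]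
    linarith [E.nonneg (w n - v)]
  subst hvu
  refine ⟨v.2, squeeze_zero (fun n => E.nonneg _) (fun n => ?_) hv⟩
  exact le_add_of_nonneg_right (sq_nonneg _)

theorem tendsto_approxForm (u v : E.domain) :
    Tendsto (fun n : ℕ => E.approxForm (1 / (n + 1)) u v) atTop (𝓝 (E.form u v)) := by
  have hr : ∀ n : ℕ, (0 : ℝ) < 1 / (n + 1) := fun n => Nat.one_div_pos_of_nat
  obtain ⟨_, h⟩ := E.mem_domain_of_approxForm_le u _ fun n => E.approxForm_self_le (hr n) u
  rw [tendsto_iff_dist_tendsto_zero]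
  have h0 := (h.mul_const (E.form v v)).sqrt
  rw [zero_mul, Real.sqrt_zero] at h0
  refine squeeze_zero (fun n => dist_nonneg) (fun n => ?_) h0
  rw [Real.dist_eq, E.approxForm_eq_form (hr n)]
  refine Real.abs_le_sqrt ?_
  have := E.form_cauchySchwarz (E.resolvent (1 / (n + 1)) u - u) v
  rwa [map_sub E.form, LinearMap.sub_apply, ← map_sub E.form] at this

end DirichletForm

theorem real_inner_eq_mul_real (a b : ℝ) : ⟪a, b⟫_ℝ = a * b := by
  rw [RCLike.inner_apply, conj_trivial, mul_comm]

/-! ### Cutoffs and the Leibniz defect of a bilinear form -/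

section Leibniz

variable {X : Type*} [TopologicalSpace X]

/-- Stands in for the constant `1`, which need not have compact support. -/
theorem exists_cutoff [T2Space X] [LocallyCompactSpace X] (f g : C_c(X, ℝ)) :
    ∃ χ : C_c(X, ℝ), (∀ x, χ x ∈ Set.Icc (0 : ℝ) 1) ∧ (∀ x, f x ≠ 0 → χ x = 1) ∧
      ∀ x, g x ≠ 0 → χ x = 1 := by
  obtain ⟨χ, h1, -, h2, h3⟩ := exists_continuous_one_zero_of_isCompact
    (f.hasCompactSupport.isCompact.union g.hasCompactSupport.isCompact) isClosed_empty
    (Set.disjoint_empty _)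
  refine ⟨⟨χ, h2⟩, h3, fun x hx => h1 (Or.inl (subset_tsupport _ hx)),
    fun x hx => h1 (Or.inr (subset_tsupport _ hx))⟩

/-- `B(fu, v) + B(fv, u) - B(uv, f)`, which is `2 ∫ f dΓ(u, v)` if `Γ` is the carré du champ of
the bilinear form `B`. -/
def leibnizDefect (B : C_c(X, ℝ) →ₗ[ℝ] C_c(X, ℝ) →ₗ[ℝ] ℝ) (f u v : C_c(X, ℝ)) : ℝ :=
  B (f * u) v + B (f * v) u - B (u * v) f

variable (B : C_c(X, ℝ) →ₗ[ℝ] C_c(X, ℝ) →ₗ[ℝ] ℝ)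

theorem leibnizDefect_polarization (f u v : C_c(X, ℝ)) :
    4 * leibnizDefect B f u v =
      leibnizDefect B f (u + v) (u + v) - leibnizDefect B f (u - v) (u - v) := by
  simp only [leibnizDefect, mul_add, add_mul, mul_sub, sub_mul, map_add, map_sub,
    LinearMap.add_apply, LinearMap.sub_apply, mul_comm v u]
  ring

theorem abs_leibnizDefect_le
    (H : ∀ (f u : C_c(X, ℝ)) (M : ℝ), (∀ x, |f x| ≤ M) → |leibnizDefect B f u u| ≤ 2 * M * B u u)
    (f u v : C_c(X, ℝ)) (M : ℝ) (hf : ∀ x, |f x| ≤ M) :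
    |leibnizDefect B f u v| ≤ M * (B u u + B v v) := by
  have h := leibnizDefect_polarization B f u v
  have h1 := abs_le.1 (H f (u + v) M hf)
  have h2 := abs_le.1 (H f (u - v) M hf)
  have h3 : B (u + v) (u + v) + B (u - v) (u - v) = 2 * (B u u + B v v) := by
    simp only [map_add, map_sub, LinearMap.add_apply, LinearMap.sub_apply]
    ring
  have h4 : 2 * M * B (u + v) (u + v) + 2 * M * B (u - v) (u - v) = 4 * (M * (B u u + B v v)) := by
    rw [← mul_add, h3]; ring
  rw [abs_le]
  constructor <;> linarith

/-- The two defects of `f` and `g` against `f * g` add up to `2 B(fg, fg)`. Each is bounded with a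
term `B(fg, fg) / 2`, so half of the left side is absorbed. -/
theorem apply_mul_self_le (symm : ∀ u v, B u v = B v u)
    (H : ∀ (f u : C_c(X, ℝ)) (M : ℝ), (∀ x, |f x| ≤ M) → |leibnizDefect B f u u| ≤ 2 * M * B u u)
    (f g : C_c(X, ℝ)) {M N : ℝ} (hM : 0 < M) (hN : 0 < N) (hf : ∀ x, |f x| ≤ M)
    (hg : ∀ x, |g x| ≤ N) :
    B (f * g) (f * g) ≤ 2 * M ^ 2 * B g g + 2 * N ^ 2 * B f f := by
  have key : ∀ (f g h : C_c(X, ℝ)) (M : ℝ), 0 < M → (∀ x, |f x| ≤ M) →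
      leibnizDefect B f g h ≤ 2 * M ^ 2 * B g g + B h h / 2 := fun f g h M hM hf => by
    -- Scaling `g` by `2 * M` balances the inequality so that `B h h` ends up with coefficient `1 /
    -- 2`.
    have h1 := (abs_le.1 (abs_leibnizDefect_le B H f ((2 * M) • g) h M hf)).2
    have h2 : leibnizDefect B f ((2 * M) • g) h = 2 * M * leibnizDefect B f g h := by
      simp only [leibnizDefect, mul_smul_comm, smul_mul_assoc, map_smul, LinearMap.smul_apply,
        smul_eq_mul]
      ring
    rw [h2, map_smul, map_smul, LinearMap.smul_apply, smul_eq_mul, smul_eq_mul] at h1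
    refine le_of_mul_le_mul_left ?_ (by positivity : 0 < 2 * M)
    linarith
  have h1 := key f g (f * g) M hM hf
  have h2 := key g f (f * g) N hN hg
  have h3 : leibnizDefect B f g (f * g) + leibnizDefect B g f (f * g) =
      2 * B (f * g) (f * g) := by
    simp only [leibnizDefect]
    rw [mul_comm g f, mul_comm g (f * g), mul_comm f (f * g), symm (f * g * f) g,
      symm (f * g * g) f, symm g, symm f]
    ring
  linarith

end Leibniz

/-! ### Carré du champ of the approximating forms; the core is an algebra -/

namespace DirichletForm

variable {X : Type*} [TopologicalSpace X] [MeasurableSpace X] [BorelSpace X]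
  {μ : Measure X} [IsFiniteMeasureOnCompacts μ] (E : DirichletForm μ) {t : ℝ}

theorem coeFn_ccToL2 (f : C_c(X, ℝ)) : ccToL2 μ f =ᵐ[μ] f :=
  (f.continuous.memLp_of_hasCompactSupport f.hasCompactSupport).coeFn_toLp

/-- The approximating form on continuous functions with compact support. -/
def approxCc (t : ℝ) : C_c(X, ℝ) →ₗ[ℝ] C_c(X, ℝ) →ₗ[ℝ] ℝ :=
  t⁻¹ • (innerₗ (Lp ℝ 2 μ)).compl₁₂
    ((LinearMap.id - E.domain.subtype ∘ₗ E.resolvent t) ∘ₗ ccToL2 μ) (ccToL2 μ)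

theorem approxCc_apply (f g : C_c(X, ℝ)) :
    E.approxCc t f g = E.approxForm t (ccToL2 μ f) (ccToL2 μ g) := rfl

theorem approxCc_eq (f g : C_c(X, ℝ)) :
    E.approxCc t f g = t⁻¹ * (⟪ccToL2 μ f, ccToL2 μ g⟫_ℝ -
      ⟪(E.resolvent t (ccToL2 μ f) : Lp ℝ 2 μ), ccToL2 μ g⟫_ℝ) := by
  rw [approxCc_apply, approxForm, inner_sub_left]

theorem approxCc_symm (ht : 0 < t) (f g : C_c(X, ℝ)) :
    E.approxCc t f g = E.approxCc t g f := by
  rw [approxCc_eq, approxCc_eq, E.inner_resolvent_comm ht, real_inner_comm,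
    real_inner_comm (E.resolvent t (ccToL2 μ g) : Lp ℝ 2 μ)]

theorem resolvent_ccToL2_mem_Icc (ht : 0 < t) (f : C_c(X, ℝ))
    (hf : ∀ x, f x ∈ Set.Icc (0 : ℝ) 1) :
    ∀ᵐ x ∂μ, (E.resolvent t (ccToL2 μ f) : Lp ℝ 2 μ) x ∈ Set.Icc (0 : ℝ) 1 := by
  refine E.resolvent_mem_Icc ht _ ?_
  filter_upwards [coeFn_ccToL2 (μ := μ) f] with x hx
  rw [hx]
  exact hf x

theorem resolvent_ccToL2_nonneg (ht : 0 < t) (f : C_c(X, ℝ)) (hf : ∀ x, 0 ≤ f x) :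
    ∀ᵐ x ∂μ, 0 ≤ (E.resolvent t (ccToL2 μ f) : Lp ℝ 2 μ) x := by
  obtain ⟨C, hC⟩ := f.hasCompactSupport.exists_bound_of_continuous f.continuous
  set M := max C 1
  have hM : 0 < M := lt_max_of_lt_right one_pos
  have h := E.resolvent_ccToL2_mem_Icc ht (M⁻¹ • f) fun x => by
    rw [CompactlySupportedContinuousMap.smul_apply, smul_eq_mul]
    refine ⟨mul_nonneg (inv_nonneg.2 hM.le) (hf x), ?_⟩
    rw [inv_mul_le_one₀ hM]
    exact ((le_abs_self _).trans (hC x)).trans (le_max_left _ _)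
  have h1 : (E.resolvent t (ccToL2 μ (M⁻¹ • f)) : Lp ℝ 2 μ) =
      M⁻¹ • (E.resolvent t (ccToL2 μ f) : Lp ℝ 2 μ) := by
    rw [map_smul, map_smul]; rfl
  rw [h1] at h
  filter_upwards [h, Lp.coeFn_smul M⁻¹ (E.resolvent t (ccToL2 μ f) : Lp ℝ 2 μ)] with x hx h2
  rw [h2, Pi.smul_apply, smul_eq_mul] at hx
  exact nonneg_of_mul_nonneg_right hx.1 (inv_pos.2 hM)

/-- A quadratic polynomial with nonnegative values at rational points is nonnegative. -/
theorem _root_.quadratic_nonneg_of_rat {a b : ℝ} (h : ∀ c : ℚ, 0 ≤ a - 2 * c * b + (c : ℝ) ^ 2)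
    (c : ℝ) : 0 ≤ a - 2 * c * b + c ^ 2 := by
  have hcl : IsClosed {c : ℝ | 0 ≤ a - 2 * c * b + c ^ 2} :=
    isClosed_le continuous_const (by fun_prop)
  have hsub : Set.range ((↑) : ℚ → ℝ) ⊆ {c : ℝ | 0 ≤ a - 2 * c * b + c ^ 2} := by
    rintro _ ⟨q, rfl⟩
    exact h q
  exact (Rat.isDenseEmbedding_coe_real.dense.closure_eq ▸ hcl.closure_subset_iff.2 hsub)
    (Set.mem_univ c)

theorem tendsto_approxCc (f g : E.Core) :
    Tendsto (fun n : ℕ => E.approxCc (1 / (n + 1)) f g) atTop (𝓝 (E.energy f g)) := by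
  rw [Core.energy_eq]
  exact E.tendsto_approxForm ⟨_, f.2⟩ ⟨_, g.2⟩

variable [T2Space X] [LocallyCompactSpace X]

/-- Formally this is `T((u - c)²) ≥ 0` at `c = u x`. The constant is replaced by `c • χ`, with
`T(χ²) ≤ 1`, and `c` is first kept rational so that one null set serves for all `c`. -/
theorem ae_resolvent_carre_nonneg (ht : 0 < t) (u : C_c(X, ℝ)) :
    ∀ᵐ x ∂μ, 0 ≤ (E.resolvent t (ccToL2 μ (u * u)) : Lp ℝ 2 μ) x -
      2 * u x * (E.resolvent t (ccToL2 μ u) : Lp ℝ 2 μ) x + u x ^ 2 := by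
  obtain ⟨χ, hχ, hu, -⟩ := exists_cutoff u u
  have huχ : u * χ = u := CompactlySupportedContinuousMap.ext fun x => by
    by_cases h : u x = 0
    · simp [h]
    · simp [hu x h]
  have h1 : ∀ᵐ x ∂μ, ∀ c : ℚ, 0 ≤ (E.resolvent t (ccToL2 μ
      ((u - (c : ℝ) • χ) * (u - (c : ℝ) • χ))) : Lp ℝ 2 μ) x := ae_all_iff.2 fun c =>
    E.resolvent_ccToL2_nonneg ht _ fun x => mul_self_nonneg _
  have h2 := E.resolvent_ccToL2_mem_Icc ht (χ * χ) fun x =>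
    ⟨mul_self_nonneg _, mul_le_one₀ (hχ x).2 (hχ x).1 (hχ x).2⟩
  have h3 : ∀ c : ℝ, (E.resolvent t (ccToL2 μ ((u - c • χ) * (u - c • χ))) : Lp ℝ 2 μ) =
      (E.resolvent t (ccToL2 μ (u * u)) : Lp ℝ 2 μ) -
      (2 * c) • (E.resolvent t (ccToL2 μ u) : Lp ℝ 2 μ) +
      (c ^ 2) • (E.resolvent t (ccToL2 μ (χ * χ)) : Lp ℝ 2 μ) := fun c => by
    have : (u - c • χ) * (u - c • χ) = u * u - (2 * c) • u + c ^ 2 • (χ * χ) := by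
      simp only [mul_sub, sub_mul, mul_smul_comm, smul_mul_assoc, mul_comm χ u, huχ]
      module
    rw [this]
    simp only [map_add, map_sub, map_smul]
    rfl
  have h4 : ∀ᵐ x ∂μ, ∀ c : ℚ, (E.resolvent t (ccToL2 μ
      ((u - (c : ℝ) • χ) * (u - (c : ℝ) • χ))) : Lp ℝ 2 μ) x =
      (E.resolvent t (ccToL2 μ (u * u)) : Lp ℝ 2 μ) x -
      2 * c * (E.resolvent t (ccToL2 μ u) : Lp ℝ 2 μ) x +
      (c : ℝ) ^ 2 * (E.resolvent t (ccToL2 μ (χ * χ)) : Lp ℝ 2 μ) x := ae_all_iff.2 fun c => by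
    rw [h3]
    filter_upwards [Lp.coeFn_add ((E.resolvent t (ccToL2 μ (u * u)) : Lp ℝ 2 μ) -
      (2 * (c : ℝ)) • (E.resolvent t (ccToL2 μ u) : Lp ℝ 2 μ))
      (((c : ℝ) ^ 2) • (E.resolvent t (ccToL2 μ (χ * χ)) : Lp ℝ 2 μ)),
      Lp.coeFn_sub (E.resolvent t (ccToL2 μ (u * u)) : Lp ℝ 2 μ)
      ((2 * (c : ℝ)) • (E.resolvent t (ccToL2 μ u) : Lp ℝ 2 μ)),
      Lp.coeFn_smul (2 * (c : ℝ)) (E.resolvent t (ccToL2 μ u) : Lp ℝ 2 μ),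
      Lp.coeFn_smul ((c : ℝ) ^ 2) (E.resolvent t (ccToL2 μ (χ * χ)) : Lp ℝ 2 μ)]
      with x e1 e2 e3 e4
    rw [e1, Pi.add_apply, e2, Pi.sub_apply, e3, e4]
    rfl
  filter_upwards [h1, h2, h4] with x e1 e2 e4
  refine quadratic_nonneg_of_rat (fun c => ?_) (u x)
  have h5 := e1 c
  rw [e4] at h5
  have h6 := mul_le_mul_of_nonneg_left e2.2 (sq_nonneg (c : ℝ))
  linarith

/-- By symmetry of the resolvent `T`, the defect equals `t⁻¹ ∫ f (u² - 2u Tu + T(u²))`, whose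
integrand is nonnegative. -/
theorem leibnizDefect_approxCc_nonneg (ht : 0 < t) (f u : C_c(X, ℝ)) (hf : ∀ x, 0 ≤ f x) :
    0 ≤ leibnizDefect (E.approxCc t) f u u := by
  set T : C_c(X, ℝ) → Lp ℝ 2 μ := fun f => (E.resolvent t (ccToL2 μ f) : Lp ℝ 2 μ) with hT
  have h0 : ⟪ccToL2 μ (f * u), ccToL2 μ u⟫_ℝ = ⟪ccToL2 μ (u * u), ccToL2 μ f⟫_ℝ := by
    rw [L2.inner_def, L2.inner_def]
    refine integral_congr_ae ?_
    filter_upwards [coeFn_ccToL2 (μ := μ) f, coeFn_ccToL2 (μ := μ) u,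
      coeFn_ccToL2 (μ := μ) (f * u), coeFn_ccToL2 (μ := μ) (u * u)] with x h1 h2 h3 h4
    rw [h1, h2, h3, h4]
    simp only [real_inner_eq_mul_real, CompactlySupportedContinuousMap.mul_apply]
    ring
  have h1 : leibnizDefect (E.approxCc t) f u u = t⁻¹ * (⟪ccToL2 μ (u * u), ccToL2 μ f⟫_ℝ -
      2 * ⟪ccToL2 μ (f * u), T u⟫_ℝ + ⟪T (u * u), ccToL2 μ f⟫_ℝ) := by
    rw [leibnizDefect, approxCc_eq, approxCc_eq, E.inner_resolvent_comm ht (ccToL2 μ (f * u)), h0]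
    ring
  rw [h1]
  refine mul_nonneg (inv_nonneg.2 ht.le) ?_
  rw [L2.inner_def, L2.inner_def, L2.inner_def, ← integral_const_mul, ← integral_sub, ← integral_add]
  · refine integral_nonneg_of_ae ?_
    filter_upwards [coeFn_ccToL2 (μ := μ) f, E.ae_resolvent_carre_nonneg ht u,
      coeFn_ccToL2 (μ := μ) (f * u), coeFn_ccToL2 (μ := μ) (u * u)] with x h1 h2 h3 h4
    rw [h1, h3, h4]
    have := mul_nonneg (hf x) h2
    simp only [real_inner_eq_mul_real, CompactlySupportedContinuousMap.mul_apply, Pi.zero_apply, hT]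
    linarith
  · exact (L2.integrable_inner _ _).sub ((L2.integrable_inner _ _).const_mul 2)
  · exact L2.integrable_inner _ _
  · exact L2.integrable_inner _ _
  · exact (L2.integrable_inner _ _).const_mul 2

/-- Positivity is applied to `f + ε • χ ≥ 0`. The extra contribution is at most `2 * ε` times the
form at `u`, because `χ = 1 ≥ Tχ` where `u ≠ 0` makes the form at `(u², χ)` nonnegative. -/
theorem neg_le_leibnizDefect_approxCc (ht : 0 < t) (f u : C_c(X, ℝ)) {ε : ℝ} (hε : 0 ≤ ε)
    (hf : ∀ x, -ε ≤ f x) :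
    -(2 * ε * E.approxCc t u u) ≤ leibnizDefect (E.approxCc t) f u u := by
  obtain ⟨χ, hχ, hu, hf'⟩ := exists_cutoff u f
  have huχ : χ * u = u := CompactlySupportedContinuousMap.ext fun x => by
    by_cases h : u x = 0
    · simp [h]
    · simp [hu x h]
  have h1 := E.leibnizDefect_approxCc_nonneg ht (f + ε • χ) u fun x => by
    rw [CompactlySupportedContinuousMap.add_apply, CompactlySupportedContinuousMap.smul_apply,
      smul_eq_mul]
    by_cases h : f x = 0
    · rw [h, zero_add]; exact mul_nonneg hε (hχ x).1
    · rw [hf' x h]; linarith [hf x]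
  have h2 : leibnizDefect (E.approxCc t) (f + ε • χ) u u = leibnizDefect (E.approxCc t) f u u +
      ε * (2 * E.approxCc t u u - E.approxCc t (u * u) χ) := by
    simp only [leibnizDefect, add_mul, smul_mul_assoc, huχ, map_add, map_smul,
      LinearMap.add_apply, LinearMap.smul_apply, smul_eq_mul]
    ring
  have h3 : 0 ≤ E.approxCc t (u * u) χ := by
    rw [approxCc_eq, E.inner_resolvent_comm ht, ← inner_sub_right]
    refine mul_nonneg (inv_nonneg.2 ht.le) ?_
    rw [L2.inner_def]
    refine integral_nonneg_of_ae ?_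
    filter_upwards [coeFn_ccToL2 (μ := μ) χ, coeFn_ccToL2 (μ := μ) (u * u),
      Lp.coeFn_sub (ccToL2 μ χ) (E.resolvent t (ccToL2 μ χ) : Lp ℝ 2 μ),
      E.resolvent_ccToL2_mem_Icc ht χ hχ] with x e1 e2 e3 e4
    rw [e2, e3, Pi.sub_apply, e1, real_inner_eq_mul_real, CompactlySupportedContinuousMap.mul_apply,
      Pi.zero_apply]
    by_cases h : u x = 0
    · simp [h]
    · rw [hu x h]
      exact mul_nonneg (mul_self_nonneg _) (sub_nonneg.2 e4.2)
  have := mul_nonneg hε h3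
  linarith

theorem abs_leibnizDefect_approxCc_le (ht : 0 < t) (f u : C_c(X, ℝ)) (M : ℝ)
    (hf : ∀ x, |f x| ≤ M) :
    |leibnizDefect (E.approxCc t) f u u| ≤ 2 * M * E.approxCc t u u := by
  -- On an empty space the bound on `f` does not force `0 ≤ M`.
  rcases isEmpty_or_nonempty X with hX | ⟨⟨x₀⟩⟩
  · have : u = 0 := CompactlySupportedContinuousMap.ext fun x => hX.elim x
    simp [this, leibnizDefect]
  have hM := (abs_nonneg _).trans (hf x₀)
  have h1 := E.neg_le_leibnizDefect_approxCc ht f u hM fun x => (abs_le.1 (hf x)).1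
  have h2 := E.neg_le_leibnizDefect_approxCc ht (-f) u hM fun x => neg_le_neg (abs_le.1 (hf x)).2
  have h3 : leibnizDefect (E.approxCc t) (-f) u u = -leibnizDefect (E.approxCc t) f u u := by
    have : -f * u = -(f * u) := CompactlySupportedContinuousMap.ext fun x => neg_mul (f x) (u x)
    simp only [leibnizDefect, this, map_neg, LinearMap.neg_apply]
    ring
  rw [abs_le]
  constructor <;> linarith

/-- `apply_mul_self_le` bounds the approximating energies of the product independently of `t`, which
is the criterion for lying in the domain. -/
theorem mul_mem_core (f g : E.Core) : (f : C_c(X, ℝ)) * g ∈ E.core := by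
  have bound : ∀ f : C_c(X, ℝ), ∃ M : ℝ, 0 < M ∧ ∀ x, |f x| ≤ M := fun f => by
    obtain ⟨C, hC⟩ := f.hasCompactSupport.exists_bound_of_continuous f.continuous
    exact ⟨max C 1, lt_max_of_lt_right one_pos, fun x => (hC x).trans (le_max_left _ _)⟩
  obtain ⟨M, hM, hf⟩ := bound f
  obtain ⟨N, hN, hg⟩ := bound g
  have hr : ∀ n : ℕ, (0 : ℝ) < 1 / (n + 1) := fun n => Nat.one_div_pos_of_nat
  obtain ⟨h, -⟩ := E.mem_domain_of_approxForm_le (ccToL2 μ ((f : C_c(X, ℝ)) * g))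
    (2 * M ^ 2 * E.energy g g + 2 * N ^ 2 * E.energy f f) fun n => by
      rw [← approxCc_apply]
      refine (apply_mul_self_le _ (E.approxCc_symm (hr n))
        (E.abs_leibnizDefect_approxCc_le (hr n)) f g hM hN hf hg).trans ?_
      rw [Core.energy_eq, Core.energy_eq]
      gcongr
      · exact E.approxForm_self_le (hr n) ⟨_, g.2⟩
      · exact E.approxForm_self_le (hr n) ⟨_, f.2⟩
  exact h

end DirichletForm

theorem CompactlySupportedContinuousMap.exists_abs_le {X : Type*} [TopologicalSpace X]
    (f : C_c(X, ℝ)) : ∃ C, ∀ x, |f x| ≤ C :=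
  f.hasCompactSupport.exists_bound_of_continuous f.continuous

theorem CompactlySupportedContinuousMap.measurable {X : Type*} [TopologicalSpace X]
    [MeasurableSpace X] [BorelSpace X] (f : C_c(X, ℝ)) : Measurable fun x => f x :=
  f.continuous.measurable

/-! ### Integration against finite signed measures -/

namespace MeasureTheory.SignedMeasure

variable {X : Type*} [MeasurableSpace X]

instance (σ : SignedMeasure X) : IsFiniteMeasure σ.variation :=
  σ.totalVariation_eq_variation ▸ inferInstanceAs (IsFiniteMeasure σ.totalVariation)

theorem integrable_of_bound (σ : SignedMeasure X) {f : X → ℝ} (hf : Measurable f) {C : ℝ}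
    (hC : ∀ x, |f x| ≤ C) : σ.Integrable f :=
  Integrable.of_bound hf.aestronglyMeasurable C (ae_of_all _ hC)

theorem integral_toSignedMeasure' (ν : Measure X) [IsFiniteMeasure ν] (f : X → ℝ) :
    ∫ᵛ x, f x ∂•ν.toSignedMeasure = ∫ x, f x ∂ν := by
  rw [← VectorMeasure.integral_toSignedMeasure]
  congr 1
  ext
  simp

theorem integral_eq_sub (σ : SignedMeasure X) {f : X → ℝ} (hf : Measurable f) {C : ℝ}
    (hC : ∀ x, |f x| ≤ C) : ∫ᵛ x, f x ∂•σ = ∫ x, f x ∂σ.toJordanDecomposition.posPart -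
      ∫ x, f x ∂σ.toJordanDecomposition.negPart := by
  rw [← integral_toSignedMeasure', ← integral_toSignedMeasure',
    ← VectorMeasure.integral_sub_vectorMeasure (integrable_of_bound _ hf hC)
      (integrable_of_bound _ hf hC)]
  change _ = ∫ᵛ x, f x ∂•σ.toJordanDecomposition.toSignedMeasure
  rw [toSignedMeasure_toJordanDecomposition]

theorem abs_integral_le (σ : SignedMeasure X) {f : X → ℝ} {C : ℝ} (hC : ∀ x, |f x| ≤ C) :
    |∫ᵛ x, f x ∂•σ| ≤ C * σ.variation.real Set.univ := by
  have h := VectorMeasure.norm_integral_le_of_norm_le_const (μ := σ)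
    (B := ContinuousLinearMap.lsmul ℝ ℝ) (ae_of_all _ hC)
  refine h.trans ?_
  rcases isEmpty_or_nonempty X with hX | ⟨⟨x⟩⟩
  · simp [Measure.eq_zero_of_isEmpty]
  · have h1 := (abs_nonneg _).trans (hC x)
    have h2 : ‖ContinuousLinearMap.lsmul ℝ ℝ (E := ℝ)‖ ≤ 1 :=
      ContinuousLinearMap.opNorm_lsmul_le
    gcongr
    exact mul_le_of_le_one_right h1 h2

variable [TopologicalSpace X] [BorelSpace X] [T2Space X] [LocallyCompactSpace X]
  [SecondCountableTopology X]

/-- Finite total variation carries the vanishing from `S` to its uniform closure; then the two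
Jordan parts agree on `C_c(X, ℝ)` and so coincide. -/
theorem eq_zero_of_forall_integral_eq_zero (σ : SignedMeasure X) (S : Set C_c(X, ℝ))
    (hS : ∀ (f : C_c(X, ℝ)), ∀ ε > 0, ∃ g ∈ S, ∀ x, |f x - g x| < ε)
    (h : ∀ g ∈ S, ∫ᵛ x, g x ∂•σ = 0) : σ = 0 := by
  have h1 : ∀ f : C_c(X, ℝ), ∫ᵛ x, f x ∂•σ = 0 := fun f => by
    set V := σ.variation.real Set.univ with hV
    have hV0 : 0 ≤ V := measureReal_nonneg
    refine abs_nonpos_iff.1 (le_of_forall_pos_le_add fun ε hε => ?_)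
    obtain ⟨g, hg, hfg⟩ := hS f (ε / (V + 1)) (by positivity)
    obtain ⟨C, hC⟩ := f.exists_abs_le
    obtain ⟨D, hD⟩ := g.exists_abs_le
    have h2 := VectorMeasure.integral_fun_sub (B := ContinuousLinearMap.lsmul ℝ ℝ)
      (σ.integrable_of_bound f.measurable hC)
      (σ.integrable_of_bound g.measurable hD)
    rw [h g hg, sub_zero] at h2
    rw [← h2, zero_add]
    refine (σ.abs_integral_le fun x => (hfg x).le).trans ?_
    rw [← hV, div_mul_eq_mul_div, div_le_iff₀ (by positivity)]
    nlinarith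
  have h2 : σ.toJordanDecomposition.posPart = σ.toJordanDecomposition.negPart := by
    refine Measure.ext_of_integral_eq_on_compactlySupported fun f => ?_
    obtain ⟨C, hC⟩ := f.exists_abs_le
    rw [← sub_eq_zero, ← σ.integral_eq_sub f.measurable hC, h1]
  rw [← toSignedMeasure_toJordanDecomposition σ, JordanDecomposition.toSignedMeasure, ← sub_eq_zero,
    sub_zero]
  simp only [h2, sub_self]

end MeasureTheory.SignedMeasure

/-! ### Existence, uniqueness and bilinearity of energy measures -/

namespace DirichletForm

variable {X : Type*} [TopologicalSpace X] [MeasurableSpace X] [BorelSpace X]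
  {μ : Measure X} [IsFiniteMeasureOnCompacts μ] (E : DirichletForm μ)

/-- The form as a bilinear form on the core. -/
def energyForm : E.Core →ₗ[ℝ] E.Core →ₗ[ℝ] ℝ :=
  let ι : E.core →ₗ[ℝ] E.domain :=
    ((ccToL2 μ) ∘ₗ E.core.subtype).codRestrict E.domain fun f => f.2
  (E.form.compl₁₂ ι ι : E.core →ₗ[ℝ] E.core →ₗ[ℝ] ℝ)

theorem energyForm_apply (f g : E.Core) : E.energyForm f g = E.energy f g := by
  rw [Core.energy_eq]; rfl

theorem energyForm_symm (f g : E.Core) : E.energyForm f g = E.energyForm g f := E.symm _ _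

theorem energyForm_self_nonneg (f : E.Core) : 0 ≤ E.energyForm f f := E.nonneg _

theorem Core.ext {f g : E.Core} (h : (f : C_c(X, ℝ)) = g) : f = g := Subtype.ext h

theorem Core.integrable (σ : SignedMeasure X) (f : E.Core) :
    σ.Integrable fun x => (f : C_c(X, ℝ)) x := by
  obtain ⟨C, hC⟩ := (f : C_c(X, ℝ)).exists_abs_le
  exact σ.integrable_of_bound f.val.measurable hC

variable [T2Space X] [LocallyCompactSpace X]

/-- The product of two elements of the core. -/
def coreMul : E.Core →ₗ[ℝ] E.Core →ₗ[ℝ] E.Core :=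
  LinearMap.mk₂ ℝ (fun f g => ⟨(f : C_c(X, ℝ)) * g, E.mul_mem_core f g⟩)
    (fun f g h => Core.ext E (add_mul f.val g.val h.val))
    (fun c f g => Core.ext E (smul_mul_assoc c f.val g.val))
    (fun f g h => Core.ext E (mul_add f.val g.val h.val))
    (fun c f g => Core.ext E (mul_smul_comm c f.val g.val))

theorem coreMul_val (f g : E.Core) :
    ((E.coreMul f g : E.Core) : C_c(X, ℝ)) = (f : C_c(X, ℝ)) * g := rfl

theorem coreMul_comm (f g : E.Core) : E.coreMul f g = E.coreMul g f :=
  Core.ext E (mul_comm f.val g.val)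

/-- The functional `f ↦ ℰ(fg, h) + ℰ(fh, g) - ℰ(gh, f)`, which determines `Γ(g, h)`. -/
def energyDefect (g h : E.Core) : E.Core →ₗ[ℝ] ℝ :=
  E.energyForm.flip h ∘ₗ E.coreMul.flip g + E.energyForm.flip g ∘ₗ E.coreMul.flip h -
    E.energyForm (E.coreMul g h)

theorem energyDefect_apply (f g h : E.Core) : E.energyDefect g h f =
    E.energyForm (E.coreMul f g) h + E.energyForm (E.coreMul f h) g -
      E.energyForm (E.coreMul g h) f := rfl

theorem isEnergyMeasure_iff (g h : E.Core) (ν : SignedMeasure X) :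
    E.IsEnergyMeasure g h ν ↔ ∀ f : E.Core,
      2 * ∫ᵛ x, (f : C_c(X, ℝ)) x ∂•ν = E.energyDefect g h f := by
  simp only [IsEnergyMeasure, energyDefect_apply, energyForm_apply, coreMul_val]

theorem energyDefect_polarization (f g h : E.Core) : E.energyDefect g h f =
    1 / 4 * (E.energyDefect (g + h) (g + h) f - E.energyDefect (g - h) (g - h) f) := by
  simp only [energyDefect_apply, map_add, map_sub, LinearMap.add_apply, LinearMap.sub_apply,
    E.coreMul_comm h g]
  ring

/-- The core is closed under products, so each of the three terms converges. This carries the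
positivity and the bound of the approximating defects over to `ℰ`. -/
theorem tendsto_leibnizDefect (f g h : E.Core) :
    Tendsto (fun n : ℕ => leibnizDefect (E.approxCc (1 / (n + 1))) f g h) atTop
      (𝓝 (E.energyDefect g h f)) := by
  simp only [energyDefect_apply, energyForm_apply]
  exact ((E.tendsto_approxCc (E.coreMul f g) h).add
    (E.tendsto_approxCc (E.coreMul f h) g)).sub (E.tendsto_approxCc (E.coreMul g h) f)

theorem energyDefect_self_nonneg (f u : E.Core) (hf : ∀ x, 0 ≤ (f : C_c(X, ℝ)) x) :
    0 ≤ E.energyDefect u u f :=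
  ge_of_tendsto' (E.tendsto_leibnizDefect f u u) fun _ =>
    E.leibnizDefect_approxCc_nonneg Nat.one_div_pos_of_nat f u hf

theorem energyDefect_self_le (f u : E.Core) (M : ℝ) (hf : ∀ x, |(f : C_c(X, ℝ)) x| ≤ M) :
    E.energyDefect u u f ≤ 2 * M * E.energyForm u u := by
  rw [energyForm_apply]
  exact le_of_tendsto_of_tendsto' (E.tendsto_leibnizDefect f u u)
    ((E.tendsto_approxCc u u).const_mul _) fun _ =>
    (le_abs_self _).trans (E.abs_leibnizDefect_approxCc_le Nat.one_div_pos_of_nat f u M hf)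

variable {E} in
-- Regularity only gives uniform approximation, so the cutoff is close to `1` instead of equal to
-- it.
theorem IsRegular.exists_core_cutoff (hE : E.IsRegular) (f : C_c(X, ℝ)) {δ : ℝ} (hδ : 0 < δ) :
    ∃ g : E.Core, (∀ x, |(g : C_c(X, ℝ)) x| < 1 + δ) ∧
      ∀ x, f x ≠ 0 → 1 - δ < (g : C_c(X, ℝ)) x := by
  obtain ⟨χ, hχ, h1, -⟩ := exists_cutoff f f
  obtain ⟨g, hg⟩ := hE.2 χ δ hδ
  refine ⟨g, fun x => ?_, fun x hx => ?_⟩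
  · have h2 := abs_lt.1 (hg x)
    have h3 := hχ x
    change |(g : C_c(X, ℝ)) x| < 1 + δ
    exact abs_lt.2 ⟨by linarith [h3.1, h2.2], by linarith [h3.2, h2.1]⟩
  · have h2 := abs_lt.1 (hg x)
    rw [h1 x hx] at h2
    change 1 - δ < (g : C_c(X, ℝ)) x
    linarith [h2.2]

/-- M. Riesz extension from the core to `C_c(X, ℝ)`: every function with compact support is
dominated by a multiple of a square from the core. -/
theorem exists_positive_extension (hE : E.IsRegular) (u : E.Core) :
    ∃ Λ : C_c(X, ℝ) →ₚ[ℝ] ℝ, ∀ f : E.Core, 2 * Λ f = E.energyDefect u u f := by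
  let s : PointedCone ℝ C_c(X, ℝ) :=
    { carrier := {f | ∀ x, 0 ≤ f x}
      add_mem' := fun ha hb x => add_nonneg (ha x) (hb x)
      zero_mem' := fun x => le_rfl
      smul_mem' := fun c f hf x => mul_nonneg c.2 (hf x) }
  let Q : E.core →ₗ[ℝ] ℝ := E.energyDefect u u
  obtain ⟨Λ, h1, h2⟩ := riesz_extension s ⟨E.core, (1 / 2 : ℝ) • Q⟩
    (fun f hf => mul_nonneg (by norm_num) (E.energyDefect_self_nonneg f u hf)) fun y => by
      obtain ⟨C, hC⟩ := y.hasCompactSupport.exists_bound_of_continuous y.continuous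
      obtain ⟨g, -, hg⟩ := hE.exists_core_cutoff y one_half_pos
      -- Where `y ≠ 0` the cutoff exceeds `1 / 2`, so `4 * g² ≥ 1`; elsewhere nonnegativity of the
      -- square suffices.
      refine ⟨((4 * |C|) • E.coreMul g g : E.Core), fun x => ?_⟩
      change 0 ≤ 4 * |C| * (g.val x * g.val x) + y x
      by_cases h : y x = 0
      · rw [h]; have := mul_self_nonneg (g.val x); positivity
      · have h3 := hg x h
        have h4 : 1 / 4 ≤ g.val x * g.val x := by nlinarith
        have h5 := (abs_le.1 (hC x)).1
        have := mul_le_mul_of_nonneg_left h4 (abs_nonneg C)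
        linarith [le_abs_self C]
  refine ⟨PositiveLinearMap.mk₀ Λ fun f hf => h2 f hf, fun f => ?_⟩
  have h := h1 f
  change Λ f = 1 / 2 * E.energyDefect u u f at h
  change 2 * Λ f = _
  rw [h]; ring

/-- The energy measure `Γ(u, u)` as a positive measure. -/
theorem exists_measure_energyDefect (hE : E.IsRegular) (u : E.Core) :
    ∃ ν : Measure X, IsFiniteMeasure ν ∧ ν.real Set.univ ≤ 2 * E.energyForm u u ∧
      ∀ f : E.Core, 2 * ∫ x, (f : C_c(X, ℝ)) x ∂ν = E.energyDefect u u f := by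
  obtain ⟨Λ, hΛ⟩ := E.exists_positive_extension hE u
  set ν := RealRMK.rieszMeasure Λ
  have hν : ∀ f : E.Core, 2 * ∫ x, (f : C_c(X, ℝ)) x ∂ν = E.energyDefect u u f := fun f => by
    rw [RealRMK.integral_rieszMeasure, hΛ]
  -- A cutoff with error `1 / 10` has `g² ≤ 121/100` everywhere and `g² ≥ 81/100` on `K`, so `ν(K) ≤
  -- (121/81) ℰ(u, u)`. The rounding to `2` is what produces `√2` later.
  have hK : ∀ K, IsCompact K → ν.real K ≤ 2 * E.energyForm u u := fun K hK => by
    obtain ⟨χ, hχ, -, hχ', -⟩ := exists_continuous_one_zero_of_isCompact hK isClosed_empty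
      (Set.disjoint_empty _)
    obtain ⟨g, hg, hg'⟩ := hE.exists_core_cutoff ⟨χ, hχ'⟩ (show (0 : ℝ) < 1 / 10 by norm_num)
    have h1 := E.energyDefect_self_le (E.coreMul g g) u (121 / 100) fun x => by
      change |g.val x * g.val x| ≤ _
      rw [abs_mul]
      nlinarith [hg x, abs_nonneg (g.val x)]
    rw [← hν] at h1
    have h2 : ∫ x, K.indicator (fun _ => (81 / 100 : ℝ)) x ∂ν ≤
        ∫ x, ((E.coreMul g g : E.Core) : C_c(X, ℝ)) x ∂ν := by
      refine integral_mono (IntegrableOn.integrable_indicator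
        (integrableOn_const hK.measure_lt_top.ne) hK.measurableSet)
        (Continuous.integrable_of_hasCompactSupport (map_continuous _)
          (CompactlySupportedContinuousMap.hasCompactSupport _)) fun x => ?_
      change _ ≤ g.val x * g.val x
      refine Set.indicator_le' (fun x hx => ?_) (fun x _ => mul_self_nonneg _) x
      have := hg' x (by
        change χ x ≠ 0
        rw [hχ hx]; exact one_ne_zero)
      nlinarith
    rw [integral_indicator_const _ hK.measurableSet, smul_eq_mul] at h2
    linarith [E.energyForm_self_nonneg u]
  have huniv : ν Set.univ ≤ ENNReal.ofReal (2 * E.energyForm u u) := by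
    rw [isOpen_univ.measure_eq_iSup_isCompact]
    refine iSup₂_le fun K _ => iSup_le fun h => ?_
    rw [← ofReal_measureReal h.measure_lt_top.ne]
    exact ENNReal.ofReal_le_ofReal (hK K h)
  refine ⟨ν, ⟨huniv.trans_lt ENNReal.ofReal_lt_top⟩, ?_, hν⟩
  exact ENNReal.toReal_le_of_le_ofReal (by linarith [E.energyForm_self_nonneg u]) huniv

theorem exists_isEnergyMeasure (hE : E.IsRegular) (g h : E.Core) :
    ∃ ν, E.IsEnergyMeasure g h ν := by
  obtain ⟨ν, _, -, h1⟩ := E.exists_measure_energyDefect hE (g + h)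
  obtain ⟨ν', _, -, h2⟩ := E.exists_measure_energyDefect hE (g - h)
  refine ⟨(1 / 4 : ℝ) • (ν.toSignedMeasure - ν'.toSignedMeasure),
    (E.isEnergyMeasure_iff g h _).2 fun f => ?_⟩
  rw [VectorMeasure.integral_smul_vectorMeasure, VectorMeasure.integral_sub_vectorMeasure
    (Core.integrable E _ f) (Core.integrable E _ f), SignedMeasure.integral_toSignedMeasure',
    SignedMeasure.integral_toSignedMeasure', energyDefect_polarization, ← h1, ← h2, smul_eq_mul]
  ring

variable {E}

theorem IsRegular.isEnergyMeasure (hE : E.IsRegular) (g h : E.Core) :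
    E.IsEnergyMeasure g h (E.energyMeasure g h) := by
  rw [energyMeasure, dif_pos (E.exists_isEnergyMeasure hE g h)]
  exact (E.exists_isEnergyMeasure hE g h).choose_spec

theorem IsRegular.two_mul_integral (hE : E.IsRegular) (f g h : E.Core) :
    2 * ∫ᵛ x, (f : C_c(X, ℝ)) x ∂•(E.energyMeasure g h) = E.energyDefect g h f :=
  (E.isEnergyMeasure_iff g h _).1 (hE.isEnergyMeasure g h) f

variable [SecondCountableTopology X]

theorem IsRegular.signedMeasure_ext (hE : E.IsRegular) {σ τ : SignedMeasure X}
    (h : ∀ f : E.Core, ∫ᵛ x, (f : C_c(X, ℝ)) x ∂•σ = ∫ᵛ x, (f : C_c(X, ℝ)) x ∂•τ) : σ = τ := by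
  rw [← sub_eq_zero]
  refine SignedMeasure.eq_zero_of_forall_integral_eq_zero _ E.core (fun f ε hε => ?_)
    fun g hg => ?_
  · obtain ⟨g, hg⟩ := hE.2 f ε hε
    exact ⟨g, g.2, hg⟩
  · have := h ⟨g, hg⟩
    exact (VectorMeasure.integral_sub_vectorMeasure (Core.integrable E _ ⟨g, hg⟩)
      (Core.integrable E _ ⟨g, hg⟩)).trans (sub_eq_zero.2 this)

theorem IsRegular.eq_energyMeasure (hE : E.IsRegular) {g h : E.Core} {ν : SignedMeasure X}
    (hν : E.IsEnergyMeasure g h ν) : ν = E.energyMeasure g h :=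
  hE.signedMeasure_ext fun f => by
    have h1 := (E.isEnergyMeasure_iff g h ν).1 hν f
    rw [← hE.two_mul_integral] at h1
    linarith

theorem IsRegular.exists_energyMeasure_self_eq (hE : E.IsRegular) (u : E.Core) :
    ∃ (ν : Measure X) (_ : IsFiniteMeasure ν), ν.real Set.univ ≤ 2 * E.energyForm u u ∧
      E.energyMeasure u u = ν.toSignedMeasure := by
  obtain ⟨ν, hfin, h1, h2⟩ := E.exists_measure_energyDefect hE u
  refine ⟨ν, hfin, h1, (hE.eq_energyMeasure ((E.isEnergyMeasure_iff u u _).2 fun f => ?_)).symm⟩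
  rw [SignedMeasure.integral_toSignedMeasure', h2]

/-- Here and in the next two lemmas, uniqueness transfers a property of the defect to the measure.
-/
theorem IsRegular.energyMeasure_symm (hE : E.IsRegular) (g h : E.Core) :
    E.energyMeasure g h = E.energyMeasure h g :=
  hE.eq_energyMeasure ((E.isEnergyMeasure_iff h g _).2 fun f => by
    rw [hE.two_mul_integral, energyDefect_apply, energyDefect_apply, E.coreMul_comm h g]
    ring)

theorem IsRegular.energyMeasure_add_left (hE : E.IsRegular) (g g' h : E.Core) :
    E.energyMeasure (g + g') h = E.energyMeasure g h + E.energyMeasure g' h :=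
  (hE.eq_energyMeasure ((E.isEnergyMeasure_iff _ _ _).2 fun f => by
    rw [VectorMeasure.integral_add_vectorMeasure (Core.integrable E _ f) (Core.integrable E _ f),
      mul_add, hE.two_mul_integral, hE.two_mul_integral]
    simp only [energyDefect_apply, map_add, LinearMap.add_apply]
    ring)).symm

theorem IsRegular.energyMeasure_smul_left (hE : E.IsRegular) (c : ℝ) (g h : E.Core) :
    E.energyMeasure (c • g) h = c • E.energyMeasure g h :=
  (hE.eq_energyMeasure ((E.isEnergyMeasure_iff _ _ _).2 fun f => by
    rw [VectorMeasure.integral_smul_vectorMeasure, smul_eq_mul, mul_left_comm, hE.two_mul_integral]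
    simp only [energyDefect_apply, map_smul, LinearMap.smul_apply, smul_eq_mul]
    ring)).symm

/-- The energy measure as a bilinear map. -/
def IsRegular.energyMeasureₗ (hE : E.IsRegular) : E.Core →ₗ[ℝ] E.Core →ₗ[ℝ] SignedMeasure X :=
  LinearMap.mk₂ ℝ E.energyMeasure hE.energyMeasure_add_left hE.energyMeasure_smul_left
    (fun g h h' => by
      rw [hE.energyMeasure_symm, hE.energyMeasure_add_left, hE.energyMeasure_symm h,
        hE.energyMeasure_symm h'])
    (fun c g h => by
      rw [hE.energyMeasure_symm, hE.energyMeasure_smul_left, hE.energyMeasure_symm h])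

theorem IsRegular.energyMeasureₗ_apply (hE : E.IsRegular) (g h : E.Core) :
    hE.energyMeasureₗ g h = E.energyMeasure g h := rfl

end DirichletForm

/-! ### Positivity of the scalar product on `𝒞 ⊗ B_b(X)` -/

namespace DirichletForm

section BoundedBorelPairing

variable {X : Type*} [MeasurableSpace X]

theorem _root_.BoundedBorel.integrable (σ : SignedMeasure X) (b : BoundedBorel X) :
    σ.Integrable fun x => (b : X → ℝ) x :=
  let ⟨_, hC⟩ := b.2.2
  σ.integrable_of_bound b.2.1 hC

/-- The pairing of finite signed measures with bounded Borel functions. -/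
def _root_.BoundedBorel.pairing : SignedMeasure X →ₗ[ℝ] BoundedBorel X →ₗ[ℝ] ℝ :=
  LinearMap.mk₂ ℝ (fun σ b => ∫ᵛ x, (b : X → ℝ) x ∂•σ)
    (fun σ τ b => VectorMeasure.integral_add_vectorMeasure (BoundedBorel.integrable σ b)
      (BoundedBorel.integrable τ b))
    (fun c _ _ => VectorMeasure.integral_smul_vectorMeasure _ c)
    (fun σ b d => VectorMeasure.integral_fun_add (BoundedBorel.integrable σ b)
      (BoundedBorel.integrable σ d))
    (fun c _ _ => VectorMeasure.integral_fun_smul _ _ c _)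

theorem _root_.MeasureTheory.SimpleFunc.integrable_mul_apply {ι : Type*} (σ : SignedMeasure X)
    (s : SimpleFunc X (ι → ℝ)) (i j : ι) : σ.Integrable fun x => s x i * s x j := by
  have h := (s.map fun p : ι → ℝ => p i * p j).integrable_of_isFiniteMeasure (μ := σ.variation)
  rwa [SimpleFunc.coe_map] at h

end BoundedBorelPairing

variable {X : Type*} [TopologicalSpace X] [MeasurableSpace X] [BorelSpace X]
  {μ : Measure X} [IsFiniteMeasureOnCompacts μ] {E : DirichletForm μ}

variable (E) in
/-- The class of a simple tensor, as a bilinear map. -/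
def tensorₗ : E.Core →ₗ[ℝ] BoundedBorel X →ₗ[ℝ] E.OneForm :=
  (TensorProduct.mk ℝ E.Core (BoundedBorel X)).compr₂
    (UniformSpace.Completion.toComplₗᵢ (𝕜 := ℝ) (E := E.PreOneForm)).toLinearMap

theorem tensorₗ_apply (a : E.Core) (b : BoundedBorel X) : E.tensorₗ a b = E.tensor a b := rfl

theorem energyForm_self_le (u : E.Core) : E.energyForm u u ≤ ‖u‖ ^ 2 := by
  have h0 : 0 ≤ ⨆ x, |(u : C_c(X, ℝ)) x| := Real.iSup_nonneg fun _ => abs_nonneg _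
  rw [Core.norm_def, ← energyForm_apply]
  calc E.energyForm u u = √(E.energyForm u u) ^ 2 := (Real.sq_sqrt (E.energyForm_self_nonneg u)).symm
    _ ≤ _ := by gcongr; linarith

theorem Core.abs_apply_le_norm (u : E.Core) (x : X) : |(u : C_c(X, ℝ)) x| ≤ ‖u‖ := by
  rw [Core.norm_def]
  exact (le_ciSup (Core.bddAbove E u) x).trans (le_add_of_nonneg_left (Real.sqrt_nonneg _))

/-- Integration against a finite signed measure, as a bounded functional on the core. -/
def integralDual (σ : SignedMeasure X) : E.CoreDual :=
  LinearMap.mkContinuous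
    { toFun := fun u : E.Core => ∫ᵛ x, (u : C_c(X, ℝ)) x ∂•σ
      map_add' := fun u v => VectorMeasure.integral_fun_add (Core.integrable E σ u)
        (Core.integrable E σ v)
      map_smul' := fun c _ => VectorMeasure.integral_fun_smul _ _ c _ }
    (σ.variation.real Set.univ) fun u =>
      (σ.abs_integral_le (Core.abs_apply_le_norm u)).trans_eq (mul_comm _ _)

theorem integralDual_apply (σ : SignedMeasure X) (u : E.Core) :
    integralDual (E := E) σ u = ∫ᵛ x, (u : C_c(X, ℝ)) x ∂•σ := rfl

variable [T2Space X] [LocallyCompactSpace X] [SecondCountableTopology X]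

section Positivity

variable {ι : Type*} [Fintype ι]

theorem IsRegular.energyMeasure_self_nonneg (hE : E.IsRegular) (u : E.Core) (A : Set X) :
    0 ≤ E.energyMeasure u u A := by
  obtain ⟨ν, _, -, h⟩ := hE.exists_energyMeasure_self_eq u
  rw [h]
  by_cases hA : MeasurableSet A
  · rw [Measure.toSignedMeasure_apply_measurable hA]
    exact measureReal_nonneg
  · rw [VectorMeasure.not_measurable _ hA]

/-- A single vector-valued simple function gives all coefficients a common partition. On a piece `A`
with value `c` the sum is `Γ(w, w)(A) ≥ 0` with `w = ∑ cᵢ aᵢ`, and different pieces do not interact.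
-/
theorem IsRegular.sum_integral_simpleFunc_nonneg (hE : E.IsRegular) (a : ι → E.Core)
    (s : SimpleFunc X (ι → ℝ)) :
    0 ≤ ∑ i, ∑ j, ∫ᵛ x, s x i * s x j ∂•(E.energyMeasure (a i) (a j)) := by
  classical
  induction s using SimpleFunc.induction with
  | const c hs =>
    rename_i A
    have h1 : ∀ i j, ∫ᵛ x, SimpleFunc.piecewise A hs (SimpleFunc.const X c) (SimpleFunc.const X 0)
        x i * SimpleFunc.piecewise A hs (SimpleFunc.const X c) (SimpleFunc.const X 0) x j
        ∂•(E.energyMeasure (a i) (a j)) = c i * c j * E.energyMeasure (a i) (a j) A := fun i j => by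
      have h2 : (fun x => SimpleFunc.piecewise A hs (SimpleFunc.const X c) (SimpleFunc.const X 0)
          x i * SimpleFunc.piecewise A hs (SimpleFunc.const X c) (SimpleFunc.const X 0) x j) =
          A.indicator fun _ => c i * c j := by
        ext x
        by_cases hx : x ∈ A <;> simp [hx]
      rw [h2, VectorMeasure.integral_indicator_const _ hs]
      simp
    have h2 : ∑ i, ∑ j, c i * c j * E.energyMeasure (a i) (a j) A =
        E.energyMeasure (∑ i, c i • a i) (∑ i, c i • a i) A := by
      rw [← hE.energyMeasureₗ_apply]
      simp only [map_sum, map_smul, LinearMap.sum_apply, LinearMap.smul_apply, hE.energyMeasureₗ_apply,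
        FunLike.coe_sum, Finset.sum_apply, _root_.smul_apply, smul_eq_mul, Finset.mul_sum]
      rw [Finset.sum_comm]
      exact Finset.sum_congr rfl fun i _ => Finset.sum_congr rfl fun j _ => by ring
    simp only [h1, h2]
    exact hE.energyMeasure_self_nonneg _ A
  | add hfg hf hg =>
    rename_i f g
    have h0 : ∀ x, f x = 0 ∨ g x = 0 := fun x => by
      by_contra! h
      exact Set.disjoint_left.1 hfg h.1 h.2
    have h1 : ∀ i j, ∫ᵛ x, (f + g) x i * (f + g) x j ∂•(E.energyMeasure (a i) (a j)) =
        (∫ᵛ x, f x i * f x j ∂•(E.energyMeasure (a i) (a j))) +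
        ∫ᵛ x, g x i * g x j ∂•(E.energyMeasure (a i) (a j)) := fun i j => by
      rw [← VectorMeasure.integral_fun_add (f.integrable_mul_apply _ i j)
        (g.integrable_mul_apply _ i j)]
      congr 1
      ext x
      rcases h0 x with h | h <;> simp [h]
    simp only [h1, Finset.sum_add_distrib]
    exact add_nonneg hf hg

theorem IsRegular.sum_integral_nonneg (hE : E.IsRegular) (a : ι → E.Core)
    (b : ι → BoundedBorel X) : 0 ≤ ∑ i, ∑ j,
      ∫ᵛ x, (b i : X → ℝ) x * (b j : X → ℝ) x ∂•(E.energyMeasure (a i) (a j)) := by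
  set f : X → ι → ℝ := fun x i => (b i : X → ℝ) x with hf
  have hfm : Measurable f := measurable_pi_lambda _ fun i => (b i).2.1
  obtain ⟨C, hC⟩ : ∃ C, ∀ x, ‖f x‖ ≤ C := by
    choose C hC using fun i => (b i).2.2
    refine ⟨∑ i, |C i|, fun x => (pi_norm_le_iff_of_nonneg (by positivity)).2 fun i => ?_⟩
    exact ((hC i x).trans (le_abs_self _)).trans
      (Finset.single_le_sum (f := fun i => |C i|) (fun _ _ => abs_nonneg _) (Finset.mem_univ i))
  set s := SimpleFunc.approxOn f hfm Set.univ 0 (Set.mem_univ _) with hs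
  -- Approximation with base point `0` at most doubles the norm, hence `C + C`.
  have hsC : ∀ n x i, |s n x i| ≤ C + C := fun n x i =>
    ((norm_le_pi_norm (s n x) i).trans
      (SimpleFunc.norm_approxOn_zero_le hfm (Set.mem_univ _) x n)).trans
      (add_le_add (hC x) (hC x))
  have hlim : ∀ x i, Tendsto (fun n => s n x i) atTop (𝓝 (f x i)) := fun x i =>
    ((continuous_apply i).tendsto _).comp
      (SimpleFunc.tendsto_approxOn hfm (Set.mem_univ _) (by simp))
  refine ge_of_tendsto' (x := atTop)
    (tendsto_finsetSum _ fun i _ => tendsto_finsetSum _ fun j _ => ?_)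
    fun n : ℕ => hE.sum_integral_simpleFunc_nonneg a (s n)
  refine VectorMeasure.tendsto_integral_of_dominated_convergence
    (fun _ => (C + C) * (C + C)) (fun n => ((s n).integrable_mul_apply _ i j).1)
    (integrable_const _) (fun n => ae_of_all _ fun x => ?_)
    (ae_of_all _ fun x => (hlim x i).mul (hlim x j))
  rw [norm_mul]
  exact mul_le_mul (hsC n x i) (hsC n x j) (abs_nonneg _) ((abs_nonneg _).trans (hsC n x i))

end Positivity

theorem IsRegular.exists_isOneFormProduct (hE : E.IsRegular) : ∃ B, E.IsOneFormProduct B := by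
  -- `a ⊗ b` and `c ⊗ d` are sent to `Γ(a, c) ⊗ bd`, which is then integrated; bilinearity of `Γ`
  -- makes this well defined.
  let B : LinearMap.BilinForm ℝ (E.Core ⊗[ℝ] BoundedBorel X) :=
    (TensorProduct.map₂ hE.energyMeasureₗ (LinearMap.mul ℝ (BoundedBorel X))).compr₂
      (TensorProduct.lift BoundedBorel.pairing)
  have hB : ∀ (a c : E.Core) (b d : BoundedBorel X), B (a ⊗ₜ b) (c ⊗ₜ d) =
      ∫ᵛ x, (b : X → ℝ) x * (d : X → ℝ) x ∂•(E.energyMeasure a c) := fun a c b d => by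
    rw [LinearMap.compr₂_apply, TensorProduct.map₂_apply_tmul, TensorProduct.map_tmul,
      TensorProduct.lift.tmul]
    rfl
  refine ⟨B, hB, fun (v w : E.Core ⊗[ℝ] BoundedBorel X) => ?_, fun v => ?_⟩
  · change B v w = B w v
    induction v using TensorProduct.induction_on with
    | zero => simp
    | add v v' h h' => rw [map_add, map_add, LinearMap.add_apply, h, h']
    | tmul a b =>
      induction w using TensorProduct.induction_on with
      | zero => simp
      | add w w' h h' => rw [map_add, map_add, LinearMap.add_apply, h, h']
      | tmul c d =>
        rw [hB, hB, hE.energyMeasure_symm]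
        simp only [mul_comm]
  · obtain ⟨k, a, b, rfl⟩ := TensorProduct.exists_sum_tmul_eq v
    have h : B (∑ j, a j ⊗ₜ b j) (∑ j, a j ⊗ₜ b j) = ∑ i, ∑ j,
        ∫ᵛ x, (b i : X → ℝ) x * (b j : X → ℝ) x ∂•(E.energyMeasure (a i) (a j)) := by
      rw [map_sum B, LinearMap.sum_apply]
      simp only [map_sum, hB]
    exact h.symm ▸ hE.sum_integral_nonneg a b

theorem IsRegular.inner_tensor (hE : E.IsRegular) (a c : E.Core) (b d : BoundedBorel X) :
    ⟪E.tensor a b, E.tensor c d⟫_ℝ =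
      ∫ᵛ x, (b : X → ℝ) x * (d : X → ℝ) x ∂•(E.energyMeasure a c) := by
  rw [tensor, tensor, UniformSpace.Completion.inner_coe]
  change E.oneFormProduct _ _ = _
  rw [oneFormProduct, dif_pos hE.exists_isOneFormProduct]
  exact hE.exists_isOneFormProduct.choose_spec.apply_tensor a c b d

/-! ### The gradient and the divergence -/

theorem IsRegular.norm_grad_le (hE : E.IsRegular) (u : E.Core) : ‖E.grad u‖ ≤ √2 * ‖u‖ := by
  obtain ⟨ν, _, h1, h2⟩ := hE.exists_energyMeasure_self_eq u
  have h3 : ‖E.grad u‖ ^ 2 = ν.real Set.univ := by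
    rw [← real_inner_self_eq_norm_sq, grad, hE.inner_tensor, h2,
      SignedMeasure.integral_toSignedMeasure']
    simp
  refine le_of_sq_le_sq ?_ (by positivity)
  rw [h3, mul_pow, Real.sq_sqrt zero_le_two]
  linarith [E.energyForm_self_le u]

/-- The divergence `∂*`, the negative of the adjoint of the gradient. -/
def IsRegular.divergence (hE : E.IsRegular) : E.OneForm →L[ℝ] E.CoreDual :=
  LinearMap.mkContinuous₂ (-(innerₗ E.OneForm).compl₂ (E.tensorₗ.flip 1)) √2 fun v u => by
    change ‖-⟪v, E.grad u⟫_ℝ‖ ≤ _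
    rw [norm_neg, mul_right_comm, mul_comm]
    exact (norm_inner_le_norm _ _).trans
      (mul_le_mul_of_nonneg_left (hE.norm_grad_le u) (norm_nonneg _))

theorem IsRegular.divergence_apply (hE : E.IsRegular) (v : E.OneForm) (u : E.Core) :
    hE.divergence v u = -⟪v, E.grad u⟫_ℝ := rfl

theorem IsRegular.norm_divergence_le (hE : E.IsRegular) (v : E.OneForm) :
    ‖hE.divergence v‖ ≤ √2 * ‖v‖ :=
  (hE.divergence.le_opNorm v).trans (mul_le_mul_of_nonneg_right
    (LinearMap.mkContinuous₂_norm_le _ (Real.sqrt_nonneg 2) _) (norm_nonneg _))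

theorem IsRegular.isDivergence_divergence (hE : E.IsRegular) : E.IsDivergence hE.divergence :=
  fun g f u => by
    rw [hE.divergence_apply, simpleField, grad, hE.inner_tensor]
    simp [Core.toBoundedBorel]

/-- Bounded Borel coefficients can be approximated by coefficients in the core. -/
theorem IsRegular.exists_norm_tensor_sub_simpleField_lt (hE : E.IsRegular) (f : E.Core)
    (b : BoundedBorel X) {ε : ℝ} (hε : 0 < ε) :
    ∃ g : E.Core, ‖E.tensor f b - E.simpleField g f‖ < ε := by
  obtain ⟨ν, _, -, hν⟩ := hE.exists_energyMeasure_self_eq f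
  obtain ⟨C, hC⟩ := b.2.2
  have hb : MemLp (b : X → ℝ) (ENNReal.ofReal 2) ν :=
    MemLp.of_bound b.2.1.aestronglyMeasurable C (ae_of_all _ hC)
  -- With `(b - g)² ≤ 2 (b - h)² + 2 (h - g)²`, this step contributes at most `ε² / 4`.
  obtain ⟨h, hcs, hbh, hcont, -⟩ :=
    hb.exists_hasCompactSupport_integral_rpow_sub_le two_pos (show 0 < ε ^ 2 / 8 by positivity)
  set V := ν.real Set.univ with hV
  have hV0 : 0 ≤ V := measureReal_nonneg
  -- Both `δ * V` and `δ` are at most `ε / 2`, so the uniform error contributes `2 V δ² ≤ ε² / 2`;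
  -- the total stays below `ε²`. Using `V + 1` covers `V = 0`.
  set δ := ε / (2 * (V + 1)) ⊓ ε / 2 with hδ
  have hδ0 : 0 < δ := by positivity
  obtain ⟨g, hg⟩ := hE.2 ⟨⟨h, hcont⟩, hcs⟩ δ hδ0
  let g' : E.Core := g
  have hg' : ∀ x, |h x - (g' : C_c(X, ℝ)) x| < δ := hg
  refine ⟨g', ?_⟩
  have h1 : E.tensor f b - E.simpleField g' f = E.tensor f (b - g'.toBoundedBorel) := by
    rw [simpleField, ← tensorₗ_apply, ← tensorₗ_apply, ← tensorₗ_apply, map_sub]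
  obtain ⟨D, hD⟩ := (⟨⟨h, hcont⟩, hcs⟩ : C_c(X, ℝ)).exists_abs_le
  have hint : Integrable (fun x => (((b : X → ℝ) x - h x) ^ 2)) ν :=
    Integrable.of_bound ((b.2.1.sub hcont.measurable).pow_const 2).aestronglyMeasurable
      ((C + D) ^ 2) (ae_of_all _ fun x => by
        rw [norm_pow]
        have := (abs_sub ((b : X → ℝ) x) (h x)).trans (add_le_add (hC x) (hD x))
        exact pow_le_pow_left₀ (norm_nonneg _) this 2)
  have h2 : ‖E.tensor f (b - g'.toBoundedBorel)‖ ^ 2 ≤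
      ∫ x, (2 * ((b : X → ℝ) x - h x) ^ 2 + 2 * δ ^ 2) ∂ν := by
    rw [← real_inner_self_eq_norm_sq, hE.inner_tensor, hν, SignedMeasure.integral_toSignedMeasure']
    refine integral_mono_of_nonneg (ae_of_all _ fun x => mul_self_nonneg _)
      ((hint.const_mul 2).add (integrable_const _)) (ae_of_all _ fun x => ?_)
    change ((b : X → ℝ) x - (g' : C_c(X, ℝ)) x) * ((b : X → ℝ) x - (g' : C_c(X, ℝ)) x) ≤ _
    have h3 := sq_le_sq' (abs_lt.1 (hg' x)).1.le (abs_lt.1 (hg' x)).2.le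
    nlinarith [sq_nonneg (((b : X → ℝ) x - h x) - (h x - (g' : C_c(X, ℝ)) x))]
  rw [integral_add (hint.const_mul 2) (integrable_const _), integral_const_mul, integral_const,
    smul_eq_mul, ← hV] at h2
  have h3 : ∫ x, ((b : X → ℝ) x - h x) ^ 2 ∂ν ≤ ε ^ 2 / 8 := by
    refine le_trans (le_of_eq (integral_congr_ae (ae_of_all _ fun x => ?_))) hbh
    simp
  have h4 : V * δ ^ 2 ≤ ε ^ 2 / 4 := by
    have e1 : δ * (2 * (V + 1)) ≤ ε := (le_div_iff₀ (by positivity)).1 inf_le_left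
    have e2 : δ ≤ ε / 2 := inf_le_right
    have e3 : δ * V ≤ ε / 2 := by nlinarith
    have := mul_le_mul e3 e2 hδ0.le (by positivity)
    nlinarith
  rw [h1]
  refine lt_of_pow_lt_pow_left₀ 2 hε.le ?_
  nlinarith

/-- Agreement on simple fields extends by continuity to tensors with bounded Borel coefficients, by
linearity to their finite sums, and by density to the completion. -/
theorem IsRegular.eq_divergence (hE : E.IsRegular) {D : E.OneForm →L[ℝ] E.CoreDual}
    (hD : E.IsDivergence D) : D = hE.divergence := by
  have h1 : ∀ (f : E.Core) (b : BoundedBorel X),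
      D (E.tensor f b) = hE.divergence (E.tensor f b) := fun f b => by
    have hcl : IsClosed {v : E.OneForm | D v = hE.divergence v} :=
      isClosed_eq D.continuous hE.divergence.continuous
    refine hcl.closure_subset_iff.2 (Set.range_subset_iff.2 fun g => ?_)
      (Metric.mem_closure_iff.2 fun ε hε => ?_ :
        E.tensor f b ∈ closure (Set.range fun g => E.simpleField g f))
    · exact ContinuousLinearMap.ext fun u => by rw [hD, hE.isDivergence_divergence]
    · obtain ⟨g, hg⟩ := hE.exists_norm_tensor_sub_simpleField_lt f b hε
      exact ⟨_, ⟨g, rfl⟩, by rwa [dist_eq_norm]⟩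
  refine ContinuousLinearMap.ext fun v => UniformSpace.Completion.induction_on v
    (isClosed_eq D.continuous hE.divergence.continuous) fun w => ?_
  obtain ⟨k, a, b, rfl⟩ := TensorProduct.exists_sum_tmul_eq w
  have h2 : ((∑ j, E.preTensor (a j) (b j) : E.PreOneForm) : E.OneForm) =
      ∑ j, E.tensor (a j) (b j) :=
    map_sum (UniformSpace.Completion.toComplₗᵢ (𝕜 := ℝ) (E := E.PreOneForm)) _ _
  change D ((∑ j, E.preTensor (a j) (b j) : E.PreOneForm) : E.OneForm) =
    hE.divergence ((∑ j, E.preTensor (a j) (b j) : E.PreOneForm) : E.OneForm)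
  rw [h2, map_sum, map_sum]
  exact Finset.sum_congr rfl fun j _ => h1 _ _

/-- Adding `2 ∫ g dΓ(f, u)` and `2 ∫ u dΓ(f, g)` leaves only `2 ℰ(gu, f)`. Writing `gLf` as a
difference of two elements of `𝒞*` also shows that it is bounded. -/
theorem IsRegular.divergence_simpleField_sub (hE : E.IsRegular) (f g : E.Core) :
    ⇑(hE.divergence (E.simpleField g f) - integralDual (E.energyMeasure f g) : E.CoreDual) =
      E.mulGenerator g f := by
  ext u
  rw [_root_.sub_apply, hE.isDivergence_divergence, integralDual_apply, mulGenerator,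
    ← coreMul_val, ← energyForm_apply]
  have h1 := hE.two_mul_integral g f u
  have h2 := hE.two_mul_integral u f g
  rw [energyDefect_apply] at h1 h2
  rw [E.coreMul_comm u g, E.coreMul_comm u f, E.coreMul_comm f g] at h2
  linarith

/-- Both coefficients are `1`, so `⟨∂f, ∂u⟩` is the total mass `Γ(f, u)(X)`, which the hypothesis
equates with the energy. -/
theorem IsRegular.divergence_grad_of_energyMeasure_univ (hE : E.IsRegular)
    (h : ∀ g h : E.Core, E.energyMeasure g h Set.univ = E.energy g h) (f : E.Core) :
    ⇑(hE.divergence (E.grad f)) = E.generator f := by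
  ext u
  have h1 : ∫ᵛ x, ((1 : BoundedBorel X) : X → ℝ) x * ((1 : BoundedBorel X) : X → ℝ) x
      ∂•(E.energyMeasure f u) = E.energyMeasure f u Set.univ := by
    have := VectorMeasure.integral_const (μ := E.energyMeasure f u)
      (B := ContinuousLinearMap.lsmul ℝ ℝ) (1 : ℝ)
    simp
  rw [hE.divergence_apply, grad, grad, hE.inner_tensor, h1, h, generator, ← energyForm_apply,
    ← energyForm_apply, energyForm_symm]

end DirichletForm

end

theorem lemmaL {X : Type*} [TopologicalSpace X] [T2Space X] [LocallyCompactSpace X]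
    [SecondCountableTopology X] [MeasurableSpace X] [BorelSpace X]
    (μ : Measure X) [IsFiniteMeasureOnCompacts μ] [μ.IsOpenPosMeasure]
    (E : DirichletForm μ) (hE : E.IsRegular) :
    -- the objects involved are well defined
    (∀ f g : E.Core, (f : C_c(X, ℝ)) * g ∈ E.core) ∧
    (∀ g h : E.Core, E.IsEnergyMeasure g h (E.energyMeasure g h) ∧
      ∀ ν, E.IsEnergyMeasure g h ν → ν = E.energyMeasure g h) ∧
    (∀ (a c : E.Core) (b d : BoundedBorel X), ⟪E.tensor a b, E.tensor c d⟫_ℝ =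
      ∫ᵛ x, (b : X → ℝ) x * (d : X → ℝ) x ∂•(E.energyMeasure a c)) ∧
    -- the divergence and its properties
    (∃! D : E.OneForm →L[ℝ] E.CoreDual, E.IsDivergence D) ∧
    (∀ D : E.OneForm →L[ℝ] E.CoreDual, E.IsDivergence D →
      (∀ v : E.OneForm, ‖D v‖ ≤ √2 * ‖v‖) ∧
      (∀ (v : E.OneForm) (u : E.Core), D v u = -⟪v, E.grad u⟫_ℝ) ∧
      (∀ f g : E.Core, ∃ w γ : E.CoreDual, ⇑w = E.mulGenerator g f ∧
        ⇑γ = E.energyFunctional f g ∧ D (E.simpleField g f) = w + γ) ∧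
      ((∀ g h : E.Core, E.energyMeasure g h Set.univ = E.energy g h) →
        ∀ f : E.Core, ∃ w : E.CoreDual, ⇑w = E.generator f ∧ w = D (E.grad f))) := by
  refine ⟨E.mul_mem_core, fun g h => ⟨hE.isEnergyMeasure g h, fun ν => hE.eq_energyMeasure⟩,
    hE.inner_tensor, ⟨hE.divergence, hE.isDivergence_divergence, fun D hD => hE.eq_divergence hD⟩,
    fun D hD => ?_⟩
  obtain rfl := hE.eq_divergence hD
  refine ⟨hE.norm_divergence_le, hE.divergence_apply, fun f g => ?_, fun h f => ?_⟩
  · exact ⟨_, _, hE.divergence_simpleField_sub f g, rfl, (sub_add_cancel _ _).symm⟩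
  · exact ⟨_, hE.divergence_grad_of_energyMeasure_univ h f, rfl⟩
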